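/- Let $k$ be a field, $Q$ a finite quiver and $I$ an admissible ideal of the path algebra $kQ$ (that is, every path occurring in an element of $I$ has length at least two, and $I$ contains all paths of sufficiently large length). Set $\Lambda = kQ/I$. Paths are composed from left to right, $e_i$ is the idempotent of $\Lambda$ given by the trivial path at the vertex $i$, and $s(\alpha)$, $t(\alpha)$ are the source and target of an arrow $\alpha$. For a set $A$ of arrows of $Q$, let $\langle A + I\rangle$ be the ideal of $\Lambda$ generated by the arrows in $A$. An element of $kQ$ avoids an arrow $\alpha$ if no path occurring in it (with non-zero coefficient) passes through $\alpha$, and a subset of $kQ$ avoids $\alpha$ if all its elements do. For $z \in kQ$ write uniquely $z = z_A + z_{\setminus A}$, where $z_A$ is a linear combination of paths passing through at least one arrow of $A$, and $z_{\setminus A}$ is a linear combination of paths avoiding all arrows of $A$. The set $A$ is called pre-removable in $\Lambda$ if $z_A \in I$ and $z_{\setminus A} \in I$ for every $z \in I$. The quotient $\Lambda/\langle A + I\rangle$ is called an arrow removal of $\Lambda$ (in the sense of Green, Psaroudakis and Solberg) if the following two conditions hold: (i) there is a generating set $T$ of the ideal $I$ that avoids all arrows in $A$; (ii) $e_{t(\alpha_1)}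 \Lambda e_{s(\alpha_2)} = 0$ for all arrows $\alpha_1, \alpha_2 \in A$. Then: (a) For every set $A$ of arrows of $Q$, the quotient $\Lambda/\langle A + I\rangle$ is an arrow removal of $\Lambda$ if and only if $A$ is pre-removable in $\Lambda$ and $\langle A + I\rangle$ is projective as a $\Lambda$-bimodule. (b) For every arrow $\alpha$ of $Q$, the quotient $\Lambda/\langle \alpha + I\rangle$ is an arrow removal of $\Lambda$ if and only if there is a generating set of $I$ avoiding $\alpha$; that is, condition (ii) is redundant for a single arrow. -/

import Mathlib

open scoped TensorProduct

universe u v w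

noncomputable section

/-! ### Path algebras

The paths of a quiver on a vertex type `V` are Mathlib's `Quiver.Path`; products of paths are read
from left to right, i.e. `p * q` is "first `p`, then `q`". -/

/-- The type `𝓑_Q` of all paths of a quiver (including the trivial ones), with arbitrary source
and target. -/
structure QuiverPath (V : Type u) [Quiver.{v} V] where
  /-- the source of the path -/
  source : V
  /-- the target of the path -/
  target : V
  /-- the underlying path -/
  path : Quiver.Path source target

namespace QuiverPath

variable {V : Type u} [Quiver.{v} V]

/-- The length of a path, i.e. the number of its arrows. -/
def length (p : QuiverPath V) : ℕ := p.path.length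

/-- The trivial path at a vertex. -/
def trivial (i : V) : QuiverPath V := ⟨i, i, Quiver.Path.nil⟩

/-- An arrow, viewed as a path of length one. -/
def ofArrow (α : Quiver.Total V) : QuiverPath V := ⟨α.left, α.right, α.hom.toPath⟩

/-- Concatenation of composable paths. -/
def comp (p q : QuiverPath V) (h : p.target = q.source) : QuiverPath V :=
  ⟨p.source, q.target, p.path.comp (q.path.cast h.symm rfl)⟩

/-- The path `p` passes through the arrow `α`: it has the form `p₁ α p₂` for some (possibly
trivial) paths `p₁`, `p₂`. -/
def PassesThrough (p : QuiverPath V) (α : Quiver.Total V) : Prop :=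
  ∃ (p₁ : Quiver.Path p.source α.left) (p₂ : Quiver.Path α.right p.target),
    p.path = (p₁.comp α.hom.toPath).comp p₂

/-- The path `p` belongs to `𝓑_Q^A`: it passes through some arrow of `A`. -/
def PassesThroughSet (p : QuiverPath V) (A : Set (Quiver.Total V)) : Prop :=
  ∃ α ∈ A, p.PassesThrough α

theorem trivial_comp (p : QuiverPath V) (i : V) (h : i = p.source) :
    (trivial i).comp p h = p := by
  subst h
  simp [trivial, comp]

theorem comp_trivial (p : QuiverPath V) (i : V) (h : p.target = i) :
    p.comp (trivial i) h = p := by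
  subst h
  simp [trivial, comp]

theorem comp_assoc (p q r : QuiverPath V) (h : p.target = q.source) (h' : q.target = r.source) :
    (p.comp q h).comp r h' = p.comp (q.comp r h') h := by
  obtain ⟨a, b, p⟩ := p
  obtain ⟨c, d, q⟩ := q
  obtain ⟨e, f, r⟩ := r
  dsimp only at h h'
  subst h h'
  simp [comp]

end QuiverPath

/-- The path algebra `kQ`: the `k`-vector space with basis the set of all paths of the quiver. -/
def PathAlgebra (k : Type w) (V : Type u) [Field k] [Quiver.{v} V] : Type (max u v w) :=
  QuiverPath V →₀ k

namespace PathAlgebra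

variable {k : Type w} {V : Type u} [Field k] [Quiver.{v} V]

instance : AddCommGroup (PathAlgebra k V) := inferInstanceAs (AddCommGroup (QuiverPath V →₀ k))

instance : Module k (PathAlgebra k V) := inferInstanceAs (Module k (QuiverPath V →₀ k))

/-- The basis of `kQ` consisting of the paths. -/
def basis (k : Type w) (V : Type u) [Field k] [Quiver.{v} V] :
    Module.Basis (QuiverPath V) k (PathAlgebra k V) :=
  Module.Basis.ofRepr (LinearEquiv.refl k (QuiverPath V →₀ k))

/-- A path, as an element of the path algebra. -/
def ofPath (k : Type w) {V : Type u} [Field k] [Quiver.{v} V] (p : QuiverPath V) :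
    PathAlgebra k V := basis k V p

/-- The coefficient of the path `p` in `z`. -/
def coeff (z : PathAlgebra k V) (p : QuiverPath V) : k := (basis k V).repr z p

/-- The path `p` occurs in `z`. -/
def Occurs (p : QuiverPath V) (z : PathAlgebra k V) : Prop := z.coeff p ≠ 0

open Classical in
/-- The product of two paths: their concatenation if they are composable and zero otherwise. -/
def pathMul (k : Type w) {V : Type u} [Field k] [Quiver.{v} V] (p q : QuiverPath V) :
    PathAlgebra k V :=
  if h : p.target = q.source then ofPath k (p.comp q h) else 0

/-- The multiplication of `kQ`, the bilinear extension of the product of paths. -/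
def mulHom (k : Type w) (V : Type u) [Field k] [Quiver.{v} V] :
    PathAlgebra k V →ₗ[k] PathAlgebra k V →ₗ[k] PathAlgebra k V :=
  (basis k V).constr k fun p => (basis k V).constr k fun q => pathMul k p q

instance : Mul (PathAlgebra k V) := ⟨fun x y => mulHom k V x y⟩

/-- The unit of `kQ` is the sum of all trivial paths. -/
instance [Fintype V] : One (PathAlgebra k V) := ⟨∑ i : V, ofPath k (QuiverPath.trivial i)⟩

theorem mul_def (x y : PathAlgebra k V) : x * y = mulHom k V x y := rfl

theorem one_def [Fintype V] :
    (1 : PathAlgebra k V) = ∑ i : V, ofPath k (QuiverPath.trivial i) := rfl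

theorem mulHom_ofPath (p q : QuiverPath V) :
    mulHom k V (ofPath k p) (ofPath k q) = pathMul k p q := by
  simp [mulHom, ofPath]

theorem induction_ofPath {P : PathAlgebra k V → Prop} (h0 : P 0)
    (hadd : ∀ x y, P x → P y → P (x + y)) (hsmul : ∀ (c : k) x, P x → P (c • x))
    (hpath : ∀ p, P (ofPath k p)) (x : PathAlgebra k V) : P x := by
  have hx : x ∈ Submodule.span k (Set.range (basis k V)) := by
    rw [(basis k V).span_eq]; trivial
  induction hx using Submodule.span_induction with
  | mem x h => obtain ⟨p, rfl⟩ := h; exact hpath p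
  | zero => exact h0
  | add x y _ _ hx hy => exact hadd x y hx hy
  | smul c x _ hx => exact hsmul c x hx

theorem mulHom_assoc (x y z : PathAlgebra k V) :
    mulHom k V (mulHom k V x y) z = mulHom k V x (mulHom k V y z) := by
  induction x using induction_ofPath with
  | h0 => simp
  | hadd a b ha hb => simp [ha, hb]
  | hsmul c a ha => simp [ha]
  | hpath p =>
    induction y using induction_ofPath with
    | h0 => simp
    | hadd a b ha hb => simp [ha, hb]
    | hsmul c a ha => simp [ha]
    | hpath q =>
      induction z using induction_ofPath with
      | h0 => simp
      | hadd a b ha hb => simp [ha, hb]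
      | hsmul c a ha => simp [ha]
      | hpath r =>
        rw [mulHom_ofPath, mulHom_ofPath]
        by_cases h : p.target = q.source <;> by_cases h' : q.target = r.source
        · have h₁ : (p.comp q h).target = r.source := h'
          have h₂ : p.target = (q.comp r h').source := h
          simp only [pathMul, dif_pos h, dif_pos h', mulHom_ofPath]
          rw [dif_pos h₁, dif_pos h₂]
          exact congrArg _ (QuiverPath.comp_assoc p q r h h')
        · have h₁ : ¬ (p.comp q h).target = r.source := h'
          simp only [pathMul, dif_pos h, dif_neg h', mulHom_ofPath]
          rw [dif_neg h₁, map_zero]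
        · have h₂ : ¬ p.target = (q.comp r h').source := h
          simp only [pathMul, dif_neg h, dif_pos h', mulHom_ofPath]
          rw [dif_neg h₂, map_zero, LinearMap.zero_apply]
        · simp [pathMul, dif_neg h, dif_neg h']

theorem one_mulHom [Fintype V] (x : PathAlgebra k V) : mulHom k V 1 x = x := by
  classical
  have : mulHom k V 1 = LinearMap.id := by
    refine (basis k V).ext fun p => ?_
    change mulHom k V 1 (ofPath k p) = ofPath k p
    rw [one_def, map_sum, LinearMap.sum_apply, Finset.sum_eq_single p.source]
    · rw [mulHom_ofPath]
      exact (dif_pos rfl).trans (congrArg _ (QuiverPath.trivial_comp p _ rfl))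
    · intro i _ hi
      rw [mulHom_ofPath]
      exact dif_neg hi
    · intro h; exact absurd (Finset.mem_univ _) h
  rw [this]; rfl

theorem mulHom_one [Fintype V] (x : PathAlgebra k V) : mulHom k V x 1 = x := by
  classical
  have : (mulHom k V).flip 1 = LinearMap.id := by
    refine (basis k V).ext fun p => ?_
    change mulHom k V (ofPath k p) 1 = ofPath k p
    rw [one_def, map_sum, Finset.sum_eq_single p.target]
    · rw [mulHom_ofPath]
      exact (dif_pos rfl).trans (congrArg _ (QuiverPath.comp_trivial p _ rfl))
    · intro i _ hi
      rw [mulHom_ofPath]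
      exact dif_neg (fun h => hi h.symm)
    · intro h; exact absurd (Finset.mem_univ _) h
  exact LinearMap.congr_fun this x

instance [Fintype V] : Ring (PathAlgebra k V) :=
  { (inferInstance : AddCommGroup (PathAlgebra k V)) with
    mul := (· * ·)
    one := 1
    mul_assoc := mulHom_assoc
    one_mul := one_mulHom
    mul_one := mulHom_one
    zero_mul := fun x => by simp [mul_def]
    mul_zero := fun x => by simp [mul_def]
    left_distrib := fun x y z => by simp [mul_def]
    right_distrib := fun x y z => by simp [mul_def] }

instance [Fintype V] : Algebra k (PathAlgebra k V) :=
  Algebra.ofModule (fun r x y => by simp [mul_def]) (fun r x y => by simp [mul_def])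

open Classical in
/-- The component `z_A` of `z = z_A + z_{∖A}` in the span of the paths passing through some arrow
of `A`. -/
def through (A : Set (Quiver.Total V)) (z : PathAlgebra k V) : PathAlgebra k V :=
  (basis k V).repr.symm (((basis k V).repr z).filter fun p => p.PassesThroughSet A)

open Classical in
/-- The component `z_{∖A}` of `z = z_A + z_{∖A}` in the span of the paths avoiding all arrows
of `A`. -/
def avoiding (A : Set (Quiver.Total V)) (z : PathAlgebra k V) : PathAlgebra k V :=
  (basis k V).repr.symm (((basis k V).repr z).filter fun p => ¬ p.PassesThroughSet A)

/-- The subset `T` of `kQ` avoids all arrows of `A`: no path occurring in an element of `T` passes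
through an arrow of `A`. -/
def AvoidsArrows (T : Set (PathAlgebra k V)) (A : Set (Quiver.Total V)) : Prop :=
  ∀ z ∈ T, ∀ p : QuiverPath V, Occurs p z → ∀ α ∈ A, ¬ p.PassesThrough α

end PathAlgebra

/-! ### Bimodules

A bimodule over a `k`-algebra `R` (with `k` acting centrally) is a module over the enveloping
algebra `R ⊗[k] Rᵐᵒᵖ`. On `R` itself, `a ⊗ op b` acts by `x ↦ a * x * b`. -/

section Bimodule

attribute [local instance] instModuleTensorProductMop

/-- A two-sided ideal of a `k`-algebra `R`, viewed as a sub-bimodule of `R`. -/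
def TwoSidedIdeal.toSubbimodule (k : Type*) {R : Type*} [CommRing k] [Ring R] [Algebra k R]
    (J : TwoSidedIdeal R) : Submodule (R ⊗[k] Rᵐᵒᵖ) R where
  carrier := J
  add_mem' := J.add_mem
  zero_mem' := J.zero_mem
  smul_mem' c x hx := by
    change TensorProduct.Algebra.moduleAux c x ∈ J
    induction c using TensorProduct.induction_on with
    | zero => rw [map_zero]; exact J.zero_mem
    | add a b ha hb => rw [map_add]; exact J.add_mem ha hb
    | tmul a b =>
      rw [TensorProduct.Algebra.moduleAux_apply]
      exact J.mul_mem_left _ _ (J.mul_mem_right _ _ hx)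

/-- The two-sided ideal `J` of the `k`-algebra `R` is projective as an `R`-bimodule. -/
def TwoSidedIdeal.IsProjectiveBimodule (k : Type*) {R : Type*} [CommRing k] [Ring R] [Algebra k R]
    (J : TwoSidedIdeal R) : Prop :=
  Module.Projective (R ⊗[k] Rᵐᵒᵖ) (J.toSubbimodule k)

end Bimodule

/-! ### Bound quiver algebras -/

namespace BoundQuiver

open PathAlgebra

variable {k : Type w} {V : Type u} [Field k] [Quiver.{v} V] [Fintype V]

/-- An ideal `I` of `kQ` is admissible: only paths of length at least two occur in its elements,
and it contains all paths of sufficiently large length. -/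
structure IsAdmissible (I : TwoSidedIdeal (PathAlgebra k V)) : Prop where
  two_le_length : ∀ z ∈ I, ∀ p : QuiverPath V, Occurs p z → 2 ≤ p.length
  exists_length : ∃ m : ℕ, ∀ p : QuiverPath V, m ≤ p.length → ofPath k p ∈ I

/-- The quotient algebra `Λ = kQ / I`. -/
abbrev QuotAlgebra (I : TwoSidedIdeal (PathAlgebra k V)) : Type (max u v w) :=
  I.ringCon.Quotient

/-- The natural epimorphism `kQ → Λ`. -/
def proj (I : TwoSidedIdeal (PathAlgebra k V)) : PathAlgebra k V →ₐ[k] QuotAlgebra I :=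
  I.ringCon.mkₐ k

/-- The idempotent `e_i` of `Λ`. -/
def idem (I : TwoSidedIdeal (PathAlgebra k V)) (i : V) : QuotAlgebra I :=
  proj I (ofPath k (QuiverPath.trivial i))

/-- The ideal `⟨A + I⟩` of `Λ` generated by the arrows in `A`. -/
def arrowIdeal (I : TwoSidedIdeal (PathAlgebra k V)) (A : Set (Quiver.Total V)) :
    TwoSidedIdeal (QuotAlgebra I) :=
  TwoSidedIdeal.span ((fun α => proj I (ofPath k (QuiverPath.ofArrow α))) '' A)

/-- `I` has a generating set (as an ideal of `kQ`) that avoids all arrows in `A`. -/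
def HasGeneratingSetAvoiding (I : TwoSidedIdeal (PathAlgebra k V))
    (A : Set (Quiver.Total V)) : Prop :=
  ∃ T : Set (PathAlgebra k V), TwoSidedIdeal.span T = I ∧ AvoidsArrows T A

/-- `A` is pre-removable in `Λ = kQ / I`: for every `z ∈ I`, the components `z_A` and `z_{∖A}`
are in `I`. -/
def IsPreRemovable (I : TwoSidedIdeal (PathAlgebra k V)) (A : Set (Quiver.Total V)) : Prop :=
  ∀ z ∈ I, through A z ∈ I ∧ avoiding A z ∈ I

/-- `Λ / ⟨A + I⟩` is an arrow removal of `Λ = kQ / I` in the sense of Green, Psaroudakis and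
Solberg. -/
structure IsArrowRemoval (I : TwoSidedIdeal (PathAlgebra k V)) (A : Set (Quiver.Total V)) :
    Prop where
  exists_generating : HasGeneratingSetAvoiding I A
  corner_eq_zero : ∀ α₁ ∈ A, ∀ α₂ ∈ A, ∀ x : QuotAlgebra I,
    idem I α₁.right * x * idem I α₂.left = 0

end BoundQuiver

end

/-! The main tool is the derivation `fox` of kQ with values in the free Λ-bimodule on A. It sends α
∈ A to e_{s(α)} ⊗ e_{t(α)} and every other arrow to 0, so a path p goes to the sum of the terms u ⊗
v over all factorizations p = uαv with α ∈ A. If I is generated by elements avoiding A, this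
derivation vanishes on I and descends to Λ (`HasGeneratingSetAvoiding.fox_eq_zero`).

Arrow removals: z ↦ z_{∖A} is an endomorphism of kQ fixing the generators of I, hence it preserves
I, which is pre-removability. When the corners e_{t(α₁)} Λ e_{s(α₂)} vanish, only the chosen arrow
of uαv contributes to its derivative, so the descended map is bimodule linear on ⟨A + I⟩. It splits
the canonical surjection `cover` from the free bimodule, and the ideal is projective.

Conversely, `cover` maps the sum of the bimodules Λe_{s(α)} ⊗ e_{t(α)}Λ onto ⟨A + I⟩, and
admissibility puts the kernel of this restriction in the nilpotent radical. If the ideal is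
projective, the restriction is therefore injective (`corner_eq_zero_of_cover_eq_zero`). Writing
α₁qα₂ as the image of α₁q ⊗ e_{t(α₂)} and of e_{s(α₁)} ⊗ qα₂ then forces q = 0, so the corners
vanish. Moreover z_A ∈ I forces the derivative of z_A to be 0, and this relation, transported to
kQ/J with J generated by the elements of I avoiding A, shows z_A ∈ J.

For a single arrow, let q be a path from t(α) to s(α) avoiding α. If q(αq)^(n+1) is the first of
these powers to vanish in Λ, differentiating it and multiplying by (qα)^n on the left leaves a ⊗ a =
0 for a = q(αq)^n, contradicting minimality. Hence q itself is zero in Λ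
(`HasGeneratingSetAvoiding.cls_eq_zero`). -/

noncomputable section

/-! ### Arrows on a concatenation of paths -/

namespace QuiverPath

variable {V : Type u} [Quiver.{v} V]

theorem not_passesThrough_nil (a : V) (α : Quiver.Total V) :
    ¬ (⟨a, a, Quiver.Path.nil⟩ : QuiverPath V).PassesThrough α := by
  rintro ⟨p₁, p₂, h⟩
  have := congrArg Quiver.Path.length h
  simp [Quiver.Path.length_comp] at this
  omega

theorem passesThrough_cons_iff {a b c : V} (p : Quiver.Path a b) (e : b ⟶ c)
    (α : Quiver.Total V) :
    (⟨a, c, p.cons e⟩ : QuiverPath V).PassesThrough α ↔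
      (⟨a, b, p⟩ : QuiverPath V).PassesThrough α ∨ α = ⟨b, c, e⟩ := by
  obtain ⟨l, r, f⟩ := α
  constructor
  · rintro ⟨p₁, p₂, h⟩
    dsimp only at p₁ p₂ h
    cases p₂ with
    | nil =>
      right
      simp only [Quiver.Path.comp_nil, Quiver.Path.comp_toPath_eq_cons] at h
      cases h
      rfl
    | cons p₂ g =>
      left
      rw [Quiver.Path.comp_cons] at h
      cases h
      exact ⟨p₁, p₂, rfl⟩
  · rintro (⟨p₁, p₂, h⟩ | h)
    · exact ⟨p₁, p₂.cons e, by dsimp only at p₁ p₂ h ⊢; rw [h, Quiver.Path.comp_cons]⟩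
    · cases h
      exact ⟨p, Quiver.Path.nil, by simp⟩

theorem passesThrough_comp_iff {a b c : V} (p : Quiver.Path a b) (q : Quiver.Path b c)
    (α : Quiver.Total V) :
    (⟨a, c, p.comp q⟩ : QuiverPath V).PassesThrough α ↔
      (⟨a, b, p⟩ : QuiverPath V).PassesThrough α ∨
        (⟨b, c, q⟩ : QuiverPath V).PassesThrough α := by
  induction q with
  | nil => simp [not_passesThrough_nil]
  | cons q e ih => rw [Quiver.Path.comp_cons, passesThrough_cons_iff, passesThrough_cons_iff, ih,
      or_assoc]

theorem passesThroughSet_comp_iff {a b c : V} (p : Quiver.Path a b) (q : Quiver.Path b c)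
    (A : Set (Quiver.Total V)) :
    (⟨a, c, p.comp q⟩ : QuiverPath V).PassesThroughSet A ↔
      (⟨a, b, p⟩ : QuiverPath V).PassesThroughSet A ∨
        (⟨b, c, q⟩ : QuiverPath V).PassesThroughSet A := by
  simp only [PassesThroughSet, passesThrough_comp_iff, and_or_left, exists_or]

theorem passesThroughSet_cons_iff {a b c : V} (p : Quiver.Path a b) (e : b ⟶ c)
    (A : Set (Quiver.Total V)) :
    (⟨a, c, p.cons e⟩ : QuiverPath V).PassesThroughSet A ↔
      (⟨a, b, p⟩ : QuiverPath V).PassesThroughSet A ∨ (⟨b, c, e⟩ : Quiver.Total V) ∈ A := by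
  simp only [PassesThroughSet, passesThrough_cons_iff, and_or_left, exists_or, exists_eq_right]

end QuiverPath

/-! ### The endomorphism z ↦ z_{∖A} of the path algebra -/

namespace PathAlgebra

variable {k : Type w} {V : Type u} [Field k] [Quiver.{v} V]

/-- A path with given endpoints, as an element of the path algebra. -/
def single (k : Type w) {V : Type u} [Field k] [Quiver.{v} V] {a b : V} (p : Quiver.Path a b) :
    PathAlgebra k V := ofPath k ⟨a, b, p⟩

theorem single_mul_single {a b c : V} (p : Quiver.Path a b) (q : Quiver.Path b c) :
    single k p * single k q = single k (p.comp q) := by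
  rw [single, single, mul_def, mulHom_ofPath]
  exact (dif_pos rfl).trans rfl

theorem single_mul_single_of_ne {a b c d : V} (h : b ≠ c) (p : Quiver.Path a b)
    (q : Quiver.Path c d) : single k p * single k q = 0 := by
  rw [single, single, mul_def, mulHom_ofPath]
  exact dif_neg h

theorem linearMap_ext {M : Type*} [AddCommMonoid M] [Module k M] {f g : PathAlgebra k V →ₗ[k] M}
    (h : ∀ (a b : V) (p : Quiver.Path a b), f (single k p) = g (single k p)) : f = g :=
  (basis k V).ext fun ⟨a, b, p⟩ => h a b p

theorem coeff_single {a b : V} (p : Quiver.Path a b) (q : QuiverPath V) [Decidable (⟨a, b, p⟩ = q)] :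
    coeff (single k p) q = if ⟨a, b, p⟩ = q then 1 else 0 := by
  classical
  rw [coeff, single, ofPath, Module.Basis.repr_self, Finsupp.single_apply]

open Classical in
theorem avoiding_single (A : Set (Quiver.Total V)) {a b : V} (p : Quiver.Path a b) :
    avoiding A (single k p) =
      if (⟨a, b, p⟩ : QuiverPath V).PassesThroughSet A then 0 else single k p := by
  rw [avoiding, single, ofPath, Module.Basis.repr_self]
  split_ifs with h
  · rw [Finsupp.filter_single_of_neg (fun p : QuiverPath V => ¬ p.PassesThroughSet A) (not_not.2 h), map_zero]
  · rw [Finsupp.filter_single_of_pos (fun p : QuiverPath V => ¬ p.PassesThroughSet A) h, Module.Basis.repr_symm_single_one]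

theorem through_add_avoiding (A : Set (Quiver.Total V)) (z : PathAlgebra k V) :
    through A z + avoiding A z = z := by
  rw [through, avoiding, ← map_add, Finsupp.filter_add_filter_not, LinearEquiv.symm_apply_apply]

/-- `z ↦ z_{∖A}` as a linear map. -/
def avoidingHom (k : Type w) {V : Type u} [Field k] [Quiver.{v} V] (A : Set (Quiver.Total V)) :
    PathAlgebra k V →ₗ[k] PathAlgebra k V where
  toFun := avoiding A
  map_add' x y := by
    classical
    rw [avoiding, map_add, Finsupp.filter_add, map_add]; rfl
  map_smul' c x := by
    classical
    rw [avoiding, map_smul, Finsupp.filter_smul, map_smul]; rfl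

theorem avoidingHom_apply (A : Set (Quiver.Total V)) (z : PathAlgebra k V) :
    avoidingHom k A z = avoiding A z := rfl

/-- A concatenation avoids A exactly when both factors do: the paths through A span an ideal, and
the paths avoiding A span a complement closed under multiplication. -/
theorem avoiding_mul (A : Set (Quiver.Total V)) (x y : PathAlgebra k V) :
    avoiding A (x * y) = avoiding A x * avoiding A y := by
  have : (mulHom k V).compr₂ (avoidingHom k A) =
      (mulHom k V).compl₁₂ (avoidingHom k A) (avoidingHom k A) := by
    refine linearMap_ext fun a b p => linearMap_ext fun c d q => ?_
    change avoiding A (single k p * single k q) =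
      avoiding A (single k p) * avoiding A (single k q)
    classical
    by_cases h : b = c
    · subst h
      rw [single_mul_single, avoiding_single, avoiding_single, avoiding_single]
      by_cases hp : (⟨a, b, p⟩ : QuiverPath V).PassesThroughSet A <;>
      by_cases hq : (⟨b, d, q⟩ : QuiverPath V).PassesThroughSet A <;>
      simp [QuiverPath.passesThroughSet_comp_iff, hp, hq, mul_def]
      exact (single_mul_single p q).symm
    · rw [single_mul_single_of_ne h, avoiding_single, avoiding_single]
      split_ifs <;> simp [mul_def, ← avoidingHom_apply] <;> exact (single_mul_single_of_ne h p q).symm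
  exact LinearMap.congr_fun₂ this x y

theorem avoiding_eq_self_iff (A : Set (Quiver.Total V)) (z : PathAlgebra k V) :
    avoiding A z = z ↔ AvoidsArrows {z} A := by
  rw [avoiding, LinearEquiv.symm_apply_eq, Finsupp.filter_eq_self_iff]
  simp only [AvoidsArrows, Set.mem_singleton_iff, forall_eq, QuiverPath.PassesThroughSet, not_exists,
    not_and]
  rfl

theorem avoiding_avoiding (A : Set (Quiver.Total V)) (z : PathAlgebra k V) :
    avoiding A (avoiding A z) = avoiding A z := by
  classical
  rw [avoiding_eq_self_iff]
  rintro _ rfl p hp α hα h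
  refine hp ?_
  rw [coeff, avoiding, LinearEquiv.apply_symm_apply]
  exact Finsupp.filter_apply_neg _ _ (not_not.2 ⟨α, hα, h⟩)

theorem AvoidsArrows.singleton {T : Set (PathAlgebra k V)} {A : Set (Quiver.Total V)}
    (h : AvoidsArrows T A) {z : PathAlgebra k V} (hz : z ∈ T) : AvoidsArrows {z} A := by
  rintro _ rfl
  exact h _ hz

section Ring

variable [Fintype V]

/-- The preimage of I under the multiplicative map z ↦ z_{∖A} is an ideal, and it contains the
generators because they are fixed by that map. -/
theorem avoiding_mem_of_hasGeneratingSet {I : TwoSidedIdeal (PathAlgebra k V)}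
    {A : Set (Quiver.Total V)} (hI : BoundQuiver.HasGeneratingSetAvoiding I A)
    {z : PathAlgebra k V} (hz : z ∈ I) : avoiding A z ∈ I := by
  obtain ⟨T, rfl, hT⟩ := hI
  let J : TwoSidedIdeal (PathAlgebra k V) := TwoSidedIdeal.mk'
    {z | avoidingHom k A z ∈ TwoSidedIdeal.span T}
    (by rw [Set.mem_ofPred_eq, map_zero]; exact TwoSidedIdeal.zero_mem _)
    (fun hx hy => by
      rw [Set.mem_ofPred_eq, map_add]; exact TwoSidedIdeal.add_mem _ hx hy)
    (fun hx => by rw [Set.mem_ofPred_eq, map_neg]; exact TwoSidedIdeal.neg_mem _ hx)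
    (fun {x y} hy => by
      rw [Set.mem_ofPred_eq, avoidingHom_apply, avoiding_mul]
      exact TwoSidedIdeal.mul_mem_left _ _ _ hy)
    (fun {x y} hx => by
      rw [Set.mem_ofPred_eq, avoidingHom_apply, avoiding_mul]
      exact TwoSidedIdeal.mul_mem_right _ _ _ hx)
  have : TwoSidedIdeal.span T ≤ J := TwoSidedIdeal.span_le.2 fun t ht => by
    refine (TwoSidedIdeal.mem_mk' _ _ _ _ _ _ _).2 ?_
    rw [Set.mem_ofPred_eq, avoidingHom_apply, (avoiding_eq_self_iff A t).2 (hT.singleton ht)]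
    exact TwoSidedIdeal.subset_span ht
  have hz' := this hz
  rwa [TwoSidedIdeal.mem_mk'] at hz'

end Ring

end PathAlgebra

/-! ### Pre-removability, and linear maps on Λ -/

namespace BoundQuiver

open PathAlgebra

variable {k : Type w} {V : Type u} [Field k] [Quiver.{v} V] [Fintype V]

theorem HasGeneratingSetAvoiding.isPreRemovable {I : TwoSidedIdeal (PathAlgebra k V)}
    {A : Set (Quiver.Total V)} (hI : HasGeneratingSetAvoiding I A) : IsPreRemovable I A := by
  intro z hz
  have h := avoiding_mem_of_hasGeneratingSet hI hz
  refine ⟨?_, h⟩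
  rw [eq_sub_of_add_eq (through_add_avoiding A z)]
  exact I.sub_mem hz h

/-- If every path from the target to the source of an arrow in `A` which avoids `A` is in an ideal,
then so is every such path. -/
theorem single_mem_of_avoiding {I : TwoSidedIdeal (PathAlgebra k V)} {A : Set (Quiver.Total V)}
    (h : ∀ α₁ ∈ A, ∀ α₂ ∈ A, ∀ p : Quiver.Path α₁.right α₂.left,
      ¬ (⟨_, _, p⟩ : QuiverPath V).PassesThroughSet A → single k p ∈ I)
    {α₁ α₂ : Quiver.Total V} (h₁ : α₁ ∈ A) (h₂ : α₂ ∈ A) (p : Quiver.Path α₁.right α₂.left) :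
    single k p ∈ I := by
  induction hn : p.length using Nat.strong_induction_on generalizing α₂ with
  | _ n ih =>
    by_cases hp : (⟨_, _, p⟩ : QuiverPath V).PassesThroughSet A
    -- Cutting at an occurrence of β ∈ A leaves an initial segment p₁ from the target of α₁ to the
    -- source of β; it is strictly shorter, so induction applies.
    · obtain ⟨β, hβ, p₁, p₂, e⟩ := hp
      dsimp only at p₁ p₂ e
      rw [e, ← single_mul_single, ← single_mul_single]
      refine I.mul_mem_right _ _ (I.mul_mem_right _ _ (ih _ ?_ hβ p₁ rfl))
      rw [← hn, e]
      simp only [Quiver.Path.length_comp, Quiver.Path.length_toPath]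
      omega
    · exact h _ h₁ _ h₂ p hp

theorem proj_eq_zero_iff {I : TwoSidedIdeal (PathAlgebra k V)} {z : PathAlgebra k V} :
    proj I z = 0 ↔ z ∈ I :=
  (RingCon.eq _).trans Iff.rfl

theorem proj_surjective (I : TwoSidedIdeal (PathAlgebra k V)) : Function.Surjective (proj I) :=
  RingCon.mkₐ_surjective _

/-- The linear map on `kQ / I` induced by a linear map on `kQ` that vanishes on `I`. -/
theorem exists_lift (I : TwoSidedIdeal (PathAlgebra k V)) {M : Type*} [AddCommGroup M] [Module k M]
    (f : PathAlgebra k V →ₗ[k] M) (hf : ∀ z ∈ I, f z = 0) :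
    ∃ g : QuotAlgebra I →ₗ[k] M, ∀ z, g (proj I z) = f z := by
  have hs : Function.Surjective (proj I).toLinearMap := proj_surjective I
  have hle : LinearMap.ker (proj I).toLinearMap ≤ LinearMap.ker f := fun z hz =>
    hf z (proj_eq_zero_iff.1 hz)
  refine ⟨(Submodule.liftQ _ f hle) ∘ₗ
    ((proj I).toLinearMap.quotKerEquivOfSurjective hs).symm.toLinearMap, fun z => ?_⟩
  have : ((proj I).toLinearMap.quotKerEquivOfSurjective hs).symm (proj I z) =
      Submodule.Quotient.mk z := by
    rw [LinearEquiv.symm_apply_eq]; rfl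
  simp [this]

end BoundQuiver

/-! ### The enveloping algebra and the derivation with respect to A -/

namespace BoundQuiver

open PathAlgebra MulOpposite

variable {k : Type w} {V : Type u} [Field k] [Quiver.{v} V] [Fintype V]
variable {I : TwoSidedIdeal (PathAlgebra k V)}

/-- The class of a path in `Λ = kQ / I`. -/
def cls (I : TwoSidedIdeal (PathAlgebra k V)) {a b : V} (p : Quiver.Path a b) : QuotAlgebra I :=
  proj I (single k p)

theorem cls_mul_cls {a b c : V} (p : Quiver.Path a b) (q : Quiver.Path b c) :
    cls I p * cls I q = cls I (p.comp q) := by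
  rw [cls, cls, cls, ← map_mul, single_mul_single]

theorem cls_mul_cls_of_ne {a b c d : V} (h : b ≠ c) (p : Quiver.Path a b) (q : Quiver.Path c d) :
    cls I p * cls I q = 0 := by
  rw [cls, cls, ← map_mul, single_mul_single_of_ne h, map_zero]

theorem idem_eq_cls (i : V) : idem I i = cls I (Quiver.Path.nil : Quiver.Path i i) := rfl

theorem idem_mul_cls {a b : V} (p : Quiver.Path a b) : idem I a * cls I p = cls I p := by
  rw [idem_eq_cls, cls_mul_cls, Quiver.Path.nil_comp]

theorem cls_mul_idem {a b : V} (p : Quiver.Path a b) : cls I p * idem I b = cls I p := by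
  rw [idem_eq_cls, cls_mul_cls, Quiver.Path.comp_nil]

theorem idem_mul_idem (i : V) : idem I i * idem I i = idem I i := idem_mul_cls _

theorem idem_mul_cls_of_ne {i a b : V} (h : i ≠ a) (p : Quiver.Path a b) :
    idem I i * cls I p = 0 := cls_mul_cls_of_ne h _ _

theorem cls_mul_idem_of_ne {a b i : V} (h : b ≠ i) (p : Quiver.Path a b) :
    cls I p * idem I i = 0 := cls_mul_cls_of_ne h _ _

theorem cls_eq_zero_iff {a b : V} {p : Quiver.Path a b} : cls I p = 0 ↔ single k p ∈ I :=
  proj_eq_zero_iff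

theorem induction_cls {P : QuotAlgebra I → Prop} (h0 : P 0)
    (hadd : ∀ x y, P x → P y → P (x + y)) (hsmul : ∀ (c : k) x, P x → P (c • x))
    (hcls : ∀ (a b : V) (p : Quiver.Path a b), P (cls I p)) (x : QuotAlgebra I) : P x := by
  obtain ⟨z, rfl⟩ := proj_surjective I x
  induction z using induction_ofPath with
  | h0 => rwa [map_zero]
  | hadd x y hx hy => rw [map_add]; exact hadd _ _ hx hy
  | hsmul c x hx => rw [map_smul]; exact hsmul _ _ hx
  | hpath p => exact hcls _ _ p.path

/-- The class of an arrow in `Λ = kQ / I`. -/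
def arr (I : TwoSidedIdeal (PathAlgebra k V)) (α : Quiver.Total V) : QuotAlgebra I :=
  cls I α.hom.toPath

theorem idem_mul_arr (α : Quiver.Total V) : idem I α.left * arr I α = arr I α := idem_mul_cls _

theorem arr_mul_idem (α : Quiver.Total V) : arr I α * idem I α.right = arr I α := cls_mul_idem _

/-- The enveloping algebra of `Λ = kQ / I`. -/
def Env (I : TwoSidedIdeal (PathAlgebra k V)) : Type (max u v w) :=
  QuotAlgebra I ⊗[k] (QuotAlgebra I)ᵐᵒᵖ

instance : Ring (Env I) := inferInstanceAs (Ring (QuotAlgebra I ⊗[k] (QuotAlgebra I)ᵐᵒᵖ))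

instance : Algebra k (Env I) :=
  inferInstanceAs (Algebra k (QuotAlgebra I ⊗[k] (QuotAlgebra I)ᵐᵒᵖ))

/-- The element `a ⊗ b` of the enveloping algebra. -/
def bi (a b : QuotAlgebra I) : Env I := a ⊗ₜ[k] op b

theorem bi_mul_bi (a b c d : QuotAlgebra I) : bi a b * bi c d = bi (a * c) (d * b) :=
  (Algebra.TensorProduct.tmul_mul_tmul a c (op b) (op d)).trans rfl

theorem bi_add_left (a b c : QuotAlgebra I) : bi (a + b) c = bi a c + bi b c :=
  TensorProduct.add_tmul _ _ _

theorem bi_add_right (a b c : QuotAlgebra I) : bi a (b + c) = bi a b + bi a c :=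
  TensorProduct.tmul_add a (op b) (op c)

theorem bi_smul_left (r : k) (a b : QuotAlgebra I) : bi (r • a) b = r • bi a b := rfl

theorem bi_smul_right (r : k) (a b : QuotAlgebra I) : bi a (r • b) = r • bi a b :=
  TensorProduct.tmul_smul r a (op b)

theorem bi_zero_left (b : QuotAlgebra I) : bi 0 b = 0 := TensorProduct.zero_tmul _ _

theorem bi_zero_right (a : QuotAlgebra I) : bi a 0 = 0 :=
  TensorProduct.tmul_zero _ a

theorem induction_bi {P : Env I → Prop} (h0 : P 0) (hadd : ∀ x y, P x → P y → P (x + y))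
    (hbi : ∀ a b, P (bi a b)) (x : Env I) : P x :=
  TensorProduct.induction_on x h0 (fun a b => hbi a b.unop) hadd

variable {A : Set (Quiver.Total V)}

open Classical in
/-- The derivative of an arrow with respect to the arrows in `A`. -/
def foxArrow (I : TwoSidedIdeal (PathAlgebra k V)) (A : Set (Quiver.Total V))
    (α : Quiver.Total V) : A →₀ Env I :=
  if h : α ∈ A then Finsupp.single ⟨α, h⟩ (bi (idem I α.left) (idem I α.right)) else 0

/-- The derivative of a path with respect to the arrows in `A`. -/
def foxPath (I : TwoSidedIdeal (PathAlgebra k V)) (A : Set (Quiver.Total V)) {a : V} :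
    ∀ {b : V}, Quiver.Path a b → (A →₀ Env I)
  | _, .nil => 0
  | _, .cons p e => bi 1 (cls I e.toPath) • foxPath I A p + bi (cls I p) 1 • foxArrow I A ⟨_, _, e⟩

theorem foxPath_nil (a : V) : foxPath I A (.nil : Quiver.Path a a) = 0 := rfl

theorem foxPath_cons {a b c : V} (p : Quiver.Path a b) (e : b ⟶ c) :
    foxPath I A (p.cons e) =
      bi 1 (cls I e.toPath) • foxPath I A p + bi (cls I p) 1 • foxArrow I A ⟨_, _, e⟩ := rfl

theorem foxArrow_of_mem {α : Quiver.Total V} (h : α ∈ A) :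
    foxArrow I A α = Finsupp.single ⟨α, h⟩ (bi (idem I α.left) (idem I α.right)) := dif_pos h

theorem foxArrow_of_notMem {α : Quiver.Total V} (h : α ∉ A) : foxArrow I A α = 0 := dif_neg h

theorem bi_smul_foxArrow (x y : QuotAlgebra I) (α : Quiver.Total V) :
    bi (x * idem I α.left) (idem I α.right * y) • foxArrow I A α = bi x y • foxArrow I A α := by
  by_cases h : α ∈ A
  · rw [foxArrow_of_mem h, Finsupp.smul_single, Finsupp.smul_single, smul_eq_mul, smul_eq_mul,
      bi_mul_bi, bi_mul_bi, mul_assoc, idem_eq_cls, idem_eq_cls, ← mul_assoc (cls I _), cls_mul_cls,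
      cls_mul_cls]
    rfl
  · rw [foxArrow_of_notMem h, smul_zero, smul_zero]

/-- In every term u ⊗ v of the derivative, u starts where p starts and v ends where p ends. This is
what makes the Leibniz rule hold for non-composable paths too, where both of its terms must vanish.
-/
theorem idem_smul_foxPath {a b : V} (p : Quiver.Path a b) :
    bi (idem I a) (idem I b) • foxPath I A p = foxPath I A p := by
  induction p with
  | nil => rw [foxPath_nil, smul_zero]
  | cons p e ih =>
    rw [foxPath_cons, smul_add, smul_smul, smul_smul, bi_mul_bi, bi_mul_bi, cls_mul_idem,
      idem_mul_cls, one_mul, mul_one]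
    congr 1
    · conv_rhs => rw [← ih, smul_smul, bi_mul_bi, idem_mul_cls, one_mul]
    · exact (bi_smul_foxArrow _ _ _).symm.trans (.trans (by rw [idem_mul_idem, mul_one])
        (bi_smul_foxArrow _ 1 _))

theorem smul_foxPath {a b : V} (x y : QuotAlgebra I) (p : Quiver.Path a b) :
    bi x y • foxPath I A p = bi (x * idem I a) (idem I b * y) • foxPath I A p := by
  conv_lhs => rw [← idem_smul_foxPath, smul_smul, bi_mul_bi]

theorem foxPath_comp {a b c : V} (p : Quiver.Path a b) (q : Quiver.Path b c) :
    foxPath I A (p.comp q) =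
      bi (cls I p) 1 • foxPath I A q + bi 1 (cls I q) • foxPath I A p := by
  induction q with
  | nil => rw [Quiver.Path.comp_nil, foxPath_nil, smul_zero, zero_add, ← idem_eq_cls,
      smul_foxPath, one_mul, idem_mul_idem, idem_smul_foxPath]
  | cons q e ih =>
    rw [Quiver.Path.comp_cons, foxPath_cons, foxPath_cons, ih, smul_add, smul_add, smul_smul,
      smul_smul, smul_smul, smul_smul, bi_mul_bi, bi_mul_bi, bi_mul_bi, bi_mul_bi, cls_mul_cls,
      cls_mul_cls, one_mul, one_mul, mul_one, mul_one, mul_one, Quiver.Path.comp_toPath_eq_cons]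
    abel

/-- The derivation of `kQ` with values in the free `Λ`-bimodule on `A` which sends an arrow `α` in
`A` to `e_{s(α)} ⊗ e_{t(α)}` and the other arrows to zero. -/
def fox (I : TwoSidedIdeal (PathAlgebra k V)) (A : Set (Quiver.Total V)) :
    PathAlgebra k V →ₗ[k] (A →₀ Env I) :=
  (basis k V).constr k fun p => foxPath I A p.path

theorem fox_single {a b : V} (p : Quiver.Path a b) : fox I A (single k p) = foxPath I A p :=
  (basis k V).constr_basis k _ _

theorem fox_mul (x y : PathAlgebra k V) :
    fox I A (x * y) = bi (proj I x) 1 • fox I A y + bi 1 (proj I y) • fox I A x := by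
  induction x using induction_ofPath with
  | h0 => simp [bi_zero_left]
  | hadd a b ha hb => simp only [add_mul, map_add, ha, hb, bi_add_left, add_smul, smul_add]; abel
  | hsmul c a ha =>
    rw [smul_mul_assoc, map_smul, ha, map_smul, map_smul, bi_smul_left, smul_add, smul_assoc,
      smul_comm c (bi 1 _)]
  | hpath p =>
    induction y using induction_ofPath with
    | h0 => simp [bi_zero_right]
    | hadd a b ha hb => simp only [mul_add, map_add, ha, hb, bi_add_right, add_smul, smul_add]; abel
    | hsmul c a ha =>
      rw [mul_smul_comm, map_smul, ha, map_smul, map_smul, bi_smul_right, smul_add, smul_assoc,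
        smul_comm c (bi _ 1)]
    | hpath q =>
      obtain ⟨a, b, p⟩ := p
      obtain ⟨c, d, q⟩ := q
      change fox I A (single k p * single k q) =
        bi (cls I p) 1 • fox I A (single k q) + bi 1 (cls I q) • fox I A (single k p)
      rw [fox_single, fox_single]
      by_cases h : b = c
      · subst h
        rw [single_mul_single, fox_single, foxPath_comp]
      · rw [single_mul_single_of_ne h, map_zero, smul_foxPath, cls_mul_idem_of_ne h, bi_zero_left,
          zero_smul, smul_foxPath, idem_mul_cls_of_ne h, bi_zero_right, zero_smul, add_zero]

theorem foxPath_of_avoids {a b : V} (p : Quiver.Path a b)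
    (hp : ¬ (⟨a, b, p⟩ : QuiverPath V).PassesThroughSet A) : foxPath I A p = 0 := by
  induction p with
  | nil => rfl
  | cons p e ih =>
    rw [QuiverPath.passesThroughSet_cons_iff, not_or] at hp
    rw [foxPath_cons, ih hp.1, foxArrow_of_notMem hp.2, smul_zero, smul_zero, add_zero]

theorem fox_avoiding (z : PathAlgebra k V) : fox I A (avoiding A z) = 0 := by
  have : fox I A ∘ₗ avoidingHom k A = 0 := by
    refine linearMap_ext fun a b p => ?_
    classical
    rw [LinearMap.comp_apply, avoidingHom_apply, avoiding_single]
    split_ifs with h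
    · rw [map_zero, LinearMap.zero_apply]
    · rw [fox_single, foxPath_of_avoids p h, LinearMap.zero_apply]
  exact LinearMap.congr_fun this z

/-- Elements of I act as zero on the free Λ-bimodule, so by the Leibniz rule the elements of I with
zero derivative form an ideal. The generators lie in it, since paths avoiding A have derivative 0.
-/
theorem HasGeneratingSetAvoiding.fox_eq_zero (hI : HasGeneratingSetAvoiding I A)
    {z : PathAlgebra k V} (hz : z ∈ I) : fox I A z = 0 := by
  obtain ⟨T, hT, hTA⟩ := hI
  let J : TwoSidedIdeal (PathAlgebra k V) := TwoSidedIdeal.mk' {z | z ∈ I ∧ fox I A z = 0}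
    ⟨I.zero_mem, map_zero _⟩
    (fun hx hy => ⟨I.add_mem hx.1 hy.1, by rw [map_add, hx.2, hy.2, add_zero]⟩)
    (fun hx => ⟨I.neg_mem hx.1, by rw [map_neg, hx.2, neg_zero]⟩)
    (fun {x y} hy => ⟨I.mul_mem_left _ _ hy.1, by
      rw [fox_mul, hy.2, proj_eq_zero_iff.2 hy.1, bi_zero_right, smul_zero, zero_smul, add_zero]⟩)
    (fun {x y} hx => ⟨I.mul_mem_right _ _ hx.1, by
      rw [fox_mul, hx.2, proj_eq_zero_iff.2 hx.1, bi_zero_left, smul_zero, zero_smul, add_zero]⟩)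
  have : TwoSidedIdeal.span T ≤ J := TwoSidedIdeal.span_le.2 fun t ht => by
    refine (TwoSidedIdeal.mem_mk' _ _ _ _ _ _ _).2 ⟨hT ▸ TwoSidedIdeal.subset_span ht, ?_⟩
    rw [← (avoiding_eq_self_iff A t).2 (hTA.singleton ht), fox_avoiding]
  have hz' := this (hT ▸ hz)
  rw [TwoSidedIdeal.mem_mk'] at hz'
  exact hz'.2

/-- The corner condition of an arrow removal. -/
def CornersVanish (I : TwoSidedIdeal (PathAlgebra k V)) (A : Set (Quiver.Total V)) : Prop :=
  ∀ α₁ ∈ A, ∀ α₂ ∈ A, ∀ x : QuotAlgebra I, idem I α₁.right * x * idem I α₂.left = 0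

/-- In a term u ⊗ v of a derivative, v starts at the target of an arrow of A; multiplying v on the
right by yα gives a product passing through a vanishing corner. -/
theorem CornersVanish.right_smul_fox (h : CornersVanish I A) {α : Quiver.Total V} (hα : α ∈ A)
    (x y : QuotAlgebra I) (z : PathAlgebra k V) : bi x (y * arr I α) • fox I A z = 0 := by
  induction z using induction_ofPath with
  | h0 => rw [map_zero, smul_zero]
  | hadd a b ha hb => rw [map_add, smul_add, ha, hb, add_zero]
  | hsmul c a ha => rw [map_smul, smul_comm, ha, smul_zero]
  | hpath p =>
    obtain ⟨a, b, p⟩ := p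
    change bi x (y * arr I α) • fox I A (single k p) = 0
    rw [fox_single]
    induction p generalizing y with
    | nil => rw [foxPath_nil, smul_zero]
    | cons p e ih =>
      rw [foxPath_cons, smul_add, smul_smul, bi_mul_bi, ← mul_assoc, mul_one, ih, zero_add,
        smul_smul, bi_mul_bi, one_mul]
      by_cases he : (⟨_, _, e⟩ : Quiver.Total V) ∈ A
      · rw [← bi_smul_foxArrow, ← idem_mul_arr, ← mul_assoc, ← mul_assoc, h _ he _ hα, zero_mul,
          bi_zero_right, zero_smul]
      · rw [foxArrow_of_notMem he, smul_zero]

theorem CornersVanish.left_smul_fox (h : CornersVanish I A) {α : Quiver.Total V} (hα : α ∈ A)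
    (x y : QuotAlgebra I) (z : PathAlgebra k V) : bi (arr I α * x) y • fox I A z = 0 := by
  induction z using induction_ofPath with
  | h0 => rw [map_zero, smul_zero]
  | hadd a b ha hb => rw [map_add, smul_add, ha, hb, add_zero]
  | hsmul c a ha => rw [map_smul, smul_comm, ha, smul_zero]
  | hpath p =>
    obtain ⟨a, b, p⟩ := p
    change bi (arr I α * x) y • fox I A (single k p) = 0
    rw [fox_single]
    induction p generalizing y with
    | nil => rw [foxPath_nil, smul_zero]
    | cons p e ih =>
      rw [foxPath_cons, smul_add, smul_smul, bi_mul_bi, mul_one, ih, zero_add,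
        smul_smul, bi_mul_bi, one_mul]
      by_cases he : (⟨_, _, e⟩ : Quiver.Total V) ∈ A
      · have h₀ := congrArg (arr I α * ·) (h _ hα _ he (x * cls I p))
        simp only [← mul_assoc, arr_mul_idem, mul_zero] at h₀
        rw [← bi_smul_foxArrow, h₀, bi_zero_left, zero_smul]
      · rw [foxArrow_of_notMem he, smul_zero]

theorem fox_arrow {α : Quiver.Total V} (hα : α ∈ A) :
    fox I A (single k α.hom.toPath) =
      Finsupp.single ⟨α, hα⟩ (bi (idem I α.left) (idem I α.right)) := by
  rw [fox_single]
  change foxPath I A (Quiver.Path.nil.cons α.hom) = _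
  rw [foxPath_cons, foxPath_nil, smul_zero, zero_add]
  change bi (cls I _) 1 • foxArrow I A α = _
  rw [← idem_eq_cls, foxArrow_of_mem hα, Finsupp.smul_single, smul_eq_mul, bi_mul_bi, mul_one,
    idem_eq_cls, cls_mul_cls]
  rfl

/-- By the Leibniz rule there are three terms; those differentiating x or y keep a factor α on the
other side and are killed by `right_smul_fox` and `left_smul_fox`. -/
theorem CornersVanish.fox_mul_arrow_mul (h : CornersVanish I A) {α : Quiver.Total V} (hα : α ∈ A)
    (x y : PathAlgebra k V) :
    fox I A (x * single k α.hom.toPath * y) =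
      Finsupp.single ⟨α, hα⟩ (bi (proj I x * idem I α.left) (idem I α.right * proj I y)) := by
  have hl := h.left_smul_fox hα 1 1 y
  have hr := h.right_smul_fox hα 1 1 x
  rw [mul_one] at hl
  rw [one_mul] at hr
  rw [fox_mul, fox_mul, fox_arrow hα, map_mul]
  change bi (_ * arr I α) 1 • _ + _ • (_ + bi 1 (arr I α) • _) = _
  rw [hr, add_zero, ← one_mul (1 : QuotAlgebra I), ← bi_mul_bi, mul_smul, one_mul, hl, smul_zero,
    zero_add, smul_smul, bi_mul_bi, Finsupp.smul_single, smul_eq_mul, bi_mul_bi, one_mul, one_mul]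

end BoundQuiver

/-! ### A single arrow: the corner condition is automatic -/

namespace QuiverPath

variable {V : Type u} [Quiver.{v} V]

/-- The path `q α q α ⋯ α q` with `n` occurrences of `α`. -/
def loopPath (α : Quiver.Total V) (q : Quiver.Path α.right α.left) :
    ℕ → Quiver.Path α.right α.left
  | 0 => q
  | n + 1 => (loopPath α q n).comp (α.hom.toPath.comp q)

theorem le_length_loopPath (α : Quiver.Total V) (q : Quiver.Path α.right α.left) (n : ℕ) :
    n ≤ (loopPath α q n).length := by
  induction n with
  | zero => exact Nat.zero_le _
  | succ n ih =>
    simp only [loopPath, Quiver.Path.length_comp, Quiver.Path.length_toPath]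
    omega

end QuiverPath

namespace BoundQuiver

open PathAlgebra QuiverPath MulOpposite

variable {k : Type w} {V : Type u} [Field k] [Quiver.{v} V] [Fintype V]
variable {I : TwoSidedIdeal (PathAlgebra k V)} {A : Set (Quiver.Total V)}

theorem cornersVanish_of_single_mem
    (h : ∀ α₁ ∈ A, ∀ α₂ ∈ A, ∀ p : Quiver.Path α₁.right α₂.left, single k p ∈ I) :
    CornersVanish I A := by
  intro α₁ h₁ α₂ h₂ x
  induction x using induction_cls with
  | h0 => rw [mul_zero, zero_mul]
  | hadd x y hx hy => rw [mul_add, add_mul, hx, hy, add_zero]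
  | hsmul c x hx => rw [mul_smul_comm, smul_mul_assoc, hx, smul_zero]
  | hcls a b p =>
    by_cases ha : α₁.right = a
    · by_cases hb : b = α₂.left
      · subst ha hb
        rw [idem_mul_cls, cls_mul_idem]
        exact cls_eq_zero_iff.2 (h _ h₁ _ h₂ p)
      · rw [mul_assoc, cls_mul_idem_of_ne hb, mul_zero]
    · rw [idem_mul_cls_of_ne ha, zero_mul]

theorem CornersVanish.single_mem (h : CornersVanish I A) {α₁ α₂ : Quiver.Total V} (h₁ : α₁ ∈ A)
    (h₂ : α₂ ∈ A) (p : Quiver.Path α₁.right α₂.left) : single k p ∈ I := by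
  rw [← cls_eq_zero_iff, ← idem_mul_cls, ← cls_mul_idem p, ← mul_assoc, h _ h₁ _ h₂]

/-- The linear map `a ⊗ b ↦ f(a) b`. -/
def contractLeft (f : QuotAlgebra I →ₗ[k] k) : Env I →ₗ[k] QuotAlgebra I :=
  (opLinearEquiv k).symm.toLinearMap ∘ₗ
    (TensorProduct.lid k (QuotAlgebra I)ᵐᵒᵖ).toLinearMap ∘ₗ f.rTensor (QuotAlgebra I)ᵐᵒᵖ

theorem contractLeft_bi (f : QuotAlgebra I →ₗ[k] k) (a b : QuotAlgebra I) :
    contractLeft f (bi a b) = f a • b := rfl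

/-- Applying f ⊗ f for a functional f gives f(a)² = 0, and functionals on a vector space separate
points. -/
theorem bi_self_eq_zero {a : QuotAlgebra I} (h : bi a a = 0) : a = 0 := by
  rw [← Module.forall_dual_apply_eq_zero_iff k a]
  intro f
  have h' := congrArg (fun x => f (contractLeft f x)) h
  simp only [contractLeft_bi, map_smul, map_zero, smul_eq_mul] at h'
  exact mul_self_eq_zero.1 h'

theorem cls_loopPath_succ (α : Quiver.Total V) (q : Quiver.Path α.right α.left) (n : ℕ) :
    cls I (loopPath α q (n + 1)) = cls I (loopPath α q n) * (arr I α * cls I q) := by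
  rw [arr, cls_mul_cls, cls_mul_cls]; rfl

theorem pow_mul_cls_loopPath (α : Quiver.Total V) (q : Quiver.Path α.right α.left) (m n : ℕ) :
    (cls I q * arr I α) ^ m * cls I (loopPath α q n) = cls I (loopPath α q (m + n)) := by
  have h1 : ∀ n, cls I q * arr I α * cls I (loopPath α q n) = cls I (loopPath α q (n + 1)) := by
    intro n
    induction n with
    | zero => rw [cls_loopPath_succ, loopPath, mul_assoc]
    | succ n ih => rw [cls_loopPath_succ, ← mul_assoc, ih, ← cls_loopPath_succ]
  induction m generalizing n with
  | zero => rw [pow_zero, one_mul, zero_add]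
  | succ m ih => rw [pow_succ, mul_assoc, h1, ih]; congr 2; omega

/-- Each of the n occurrences of α in q(αq)^n contributes one term: what precedes it, tensored with
what follows it. Since q avoids A, there are no others. -/
theorem foxPath_loopPath {α : Quiver.Total V} (q : Quiver.Path α.right α.left)
    (hα : α ∈ A) (hq : ¬ (⟨_, _, q⟩ : QuiverPath V).PassesThroughSet A) (n : ℕ) :
    foxPath I A (loopPath α q n) = Finsupp.single ⟨α, hα⟩
      (∑ i ∈ Finset.range n, bi (cls I (loopPath α q i)) (cls I (loopPath α q (n - 1 - i)))) := by
  induction n with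
  | zero =>
    rw [Finset.sum_range_zero, Finsupp.single_zero]
    exact foxPath_of_avoids q hq
  | succ n ih =>
    rw [loopPath, foxPath_comp, foxPath_comp, foxPath_of_avoids q hq, smul_zero, zero_add,
      ← fox_single α.hom.toPath, fox_arrow hα, ih, smul_smul, bi_mul_bi, Finsupp.smul_single,
      Finsupp.smul_single, smul_eq_mul, smul_eq_mul, bi_mul_bi, mul_one, mul_one, cls_mul_idem,
      idem_mul_cls, ← Finsupp.single_add, Finset.sum_range_succ, Finset.mul_sum, add_comm]
    congr 2
    · refine Finset.sum_congr rfl fun i hi => ?_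
      rw [bi_mul_bi, one_mul, ← cls_mul_cls]
      change bi _ (_ * (arr I α * _)) = _
      rw [← cls_loopPath_succ]
      congr 3
      have := Finset.mem_range.1 hi
      omega
    · simp [loopPath]

theorem HasGeneratingSetAvoiding.cls_eq_zero (hI : IsAdmissible I) {α : Quiver.Total V}
    (h : HasGeneratingSetAvoiding I {α}) {q : Quiver.Path α.right α.left}
    (hq : ¬ (⟨_, _, q⟩ : QuiverPath V).PassesThroughSet {α}) : cls I q = 0 := by
  obtain ⟨m, hm⟩ := hI.exists_length
  -- The path q(αq)^m has length at least m, so admissibility makes it vanish in Λ for large m.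
  have hex : ∃ n, cls I (loopPath α q n) = 0 :=
    ⟨m, cls_eq_zero_iff.2 (hm _ (le_length_loopPath α q m))⟩
  classical
  rcases hn : Nat.find hex with _ | n
  · exact (Nat.find_eq_zero hex).1 hn
  · exfalso
    have h0 : cls I (loopPath α q (n + 1)) = 0 := hn ▸ Nat.find_spec hex
    have hz : ∀ i, cls I (loopPath α q (n + 1 + i)) = 0 := by
      intro i
      rw [add_comm, ← pow_mul_cls_loopPath, h0, mul_zero]
    refine Nat.find_min hex (m := n) (by omega) (bi_self_eq_zero ?_)
    have hf := h.fox_eq_zero (cls_eq_zero_iff.1 h0)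
    rw [fox_single, foxPath_loopPath q (Set.mem_singleton _) hq, Finsupp.single_eq_zero] at hf
    -- Left multiplication by (qα)^n raises the left exponent i to n + i, so every term with i ≥ 1
    -- vanishes. Only i = 0 survives, with exponent n on both sides of the tensor sign.
    have hs := congrArg (bi ((cls I q * arr I α) ^ n) 1 * ·) hf
    simp only [Finset.mul_sum, mul_zero, bi_mul_bi, pow_mul_cls_loopPath, mul_one,
      Nat.add_sub_cancel] at hs
    rw [Finset.sum_range_succ', Finset.sum_eq_zero, zero_add] at hs
    · exact hs
    · intro i _
      rw [show n + (i + 1) = n + 1 + i by omega, hz, bi_zero_left]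

/-- For a single arrow, the corner condition of an arrow removal is automatic. -/
theorem HasGeneratingSetAvoiding.cornersVanish (hI : IsAdmissible I) {α : Quiver.Total V}
    (h : HasGeneratingSetAvoiding I {α}) : CornersVanish I {α} := by
  refine cornersVanish_of_single_mem fun α₁ h₁ α₂ h₂ p => single_mem_of_avoiding ?_ h₁ h₂ p
  rintro _ rfl _ rfl q hq
  exact cls_eq_zero_iff.1 (h.cls_eq_zero hI hq)

/-! ### Arrow removals have a projective arrow ideal -/

section Projective

attribute [local instance] instModuleTensorProductMop

instance : Module (Env I) (QuotAlgebra I) :=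
  inferInstanceAs (Module (QuotAlgebra I ⊗[k] (QuotAlgebra I)ᵐᵒᵖ) (QuotAlgebra I))

theorem bi_smul (a b x : QuotAlgebra I) : bi a b • x = a * x * b := by
  change TensorProduct.Algebra.moduleAux (a ⊗ₜ[k] op b) x = _
  rw [TensorProduct.Algebra.moduleAux_apply, mul_assoc]
  rfl

/-- The ideal generated by the arrows in `A`, as a sub-bimodule of `Λ`. -/
def arrowSubmodule (I : TwoSidedIdeal (PathAlgebra k V)) (A : Set (Quiver.Total V)) :
    Submodule (Env I) (QuotAlgebra I) :=
  (arrowIdeal I A).toSubbimodule k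

theorem isProjectiveBimodule_iff :
    (arrowIdeal I A).IsProjectiveBimodule k ↔ Module.Projective (Env I) (arrowSubmodule I A) :=
  Iff.rfl

theorem arrowSubmodule_eq_span :
    arrowSubmodule I A = Submodule.span (Env I) (Set.range fun α : A => arr I α) := by
  refine le_antisymm ?_ (Submodule.span_le.2 ?_)
  · intro x hx
    let J : TwoSidedIdeal (QuotAlgebra I) := TwoSidedIdeal.mk'
      (Submodule.span (Env I) (Set.range fun α : A => arr I α))
      (Submodule.zero_mem _) (fun hx hy => Submodule.add_mem _ hx hy)
      (fun hx => Submodule.neg_mem _ hx)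
      (fun {x y} hy => by
        have := Submodule.smul_mem _ (bi x 1) hy
        rwa [bi_smul, mul_one] at this)
      (fun {x y} hx => by
        have := Submodule.smul_mem _ (bi 1 y) hx
        rwa [bi_smul, one_mul] at this)
    have hJ : arrowIdeal I A ≤ J := by
      refine TwoSidedIdeal.span_le.2 ?_
      rintro _ ⟨α, hα, rfl⟩
      exact (TwoSidedIdeal.mem_mk' _ _ _ _ _ _ _).2 (Submodule.subset_span ⟨⟨α, hα⟩, rfl⟩)
    exact (TwoSidedIdeal.mem_mk' _ _ _ _ _ _ _).1 (hJ hx)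
  · rintro _ ⟨⟨α, hα⟩, rfl⟩
    exact TwoSidedIdeal.subset_span ⟨α, hα, rfl⟩

theorem arr_mem {α : Quiver.Total V} (hα : α ∈ A) : arr I α ∈ arrowSubmodule I A := by
  rw [arrowSubmodule_eq_span]
  exact Submodule.subset_span ⟨⟨α, hα⟩, rfl⟩

/-- The bimodule homomorphism from the free bimodule on `A` onto the ideal generated by `A`. -/
def cover (I : TwoSidedIdeal (PathAlgebra k V)) (A : Set (Quiver.Total V)) :
    (A →₀ Env I) →ₗ[Env I] arrowSubmodule I A :=
  Finsupp.linearCombination (Env I) fun α : A => ⟨arr I α, arr_mem α.2⟩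

theorem cover_single (α : A) (x : Env I) :
    (cover I A (Finsupp.single α x) : QuotAlgebra I) = x • arr I α := by
  rw [cover, Finsupp.linearCombination_single]; rfl

theorem cover_surjective (I : TwoSidedIdeal (PathAlgebra k V)) (A : Set (Quiver.Total V)) :
    Function.Surjective (cover I A) := by
  rintro ⟨x, hx⟩
  have hx' := hx
  rw [arrowSubmodule_eq_span, ← Finsupp.range_linearCombination] at hx'
  obtain ⟨f, rfl⟩ := hx'
  refine ⟨f, Subtype.ext ?_⟩
  change (arrowSubmodule I A).subtype (cover I A f) = _
  rw [cover, Finsupp.apply_linearCombination]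
  rfl

/-- The descended derivation, restricted to the ideal, is a bimodule section of `cover`, which
exhibits the ideal as a direct summand of a free bimodule. -/
theorem IsArrowRemoval.isProjectiveBimodule (h : IsArrowRemoval I A) :
    (arrowIdeal I A).IsProjectiveBimodule k := by
  obtain ⟨hT, hc : CornersVanish I A⟩ := h
  obtain ⟨D, hD⟩ := exists_lift I (fox I A) fun z hz => hT.fox_eq_zero hz
  have key : ∀ (α : A) (a b : QuotAlgebra I), D (a * arr I α * b) =
      Finsupp.single α (bi (a * idem I α.1.left) (idem I α.1.right * b)) := by
    intro α a b
    obtain ⟨x, rfl⟩ := proj_surjective I a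
    obtain ⟨y, rfl⟩ := proj_surjective I b
    rw [arr, cls, ← map_mul, ← map_mul, hD, hc.fox_mul_arrow_mul α.2]
  have key' : ∀ (α : A) (x y : Env I), D ((x * y) • arr I α) = x • D (y • arr I α) := by
    intro α x y
    induction x using induction_bi with
    | h0 => rw [zero_mul, zero_smul, zero_smul, map_zero]
    | hadd x x' hx hx' => rw [add_mul, add_smul, add_smul, map_add, hx, hx']
    | hbi a b =>
      induction y using induction_bi with
      | h0 => rw [mul_zero, zero_smul, map_zero, smul_zero]
      | hadd x x' hx hx' => rw [mul_add, add_smul, add_smul, map_add, map_add, hx, hx', smul_add]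
      | hbi c d =>
        rw [bi_mul_bi, bi_smul, bi_smul, key, key, Finsupp.smul_single, smul_eq_mul, bi_mul_bi,
          mul_assoc, mul_assoc]
  -- A derivation is not bimodule linear on all of Λ; on the ideal it is, because by `key` it acts
  -- on aαb by replacing α with the tensor sign.
  have hlin : ∀ (x : Env I) (y : arrowSubmodule I A), D ((x • y : arrowSubmodule I A)) =
      x • D y := by
    intro x y
    obtain ⟨f, rfl⟩ := cover_surjective I A y
    rw [← map_smul]
    induction f using Finsupp.induction_linear with
    | zero => simp
    | add f g hf hg =>
      rw [smul_add, map_add, map_add, Submodule.coe_add, Submodule.coe_add, map_add, map_add, hf,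
        hg, smul_add]
    | single α y => rw [Finsupp.smul_single, cover_single, cover_single, smul_eq_mul, key']
  let s : arrowSubmodule I A →ₗ[Env I] (A →₀ Env I) :=
    { toFun := fun y => D y
      map_add' := fun x y => by rw [Submodule.coe_add, map_add]
      map_smul' := hlin }
  refine isProjectiveBimodule_iff.2 (Module.Projective.of_split s (cover I A) ?_)
  refine LinearMap.ext fun y => ?_
  obtain ⟨f, rfl⟩ := cover_surjective I A y
  have : (cover I A ∘ₗ s) ∘ₗ cover I A = cover I A := by
    refine Finsupp.lhom_ext' fun α => LinearMap.ext_ring (Subtype.ext ?_)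
    change (cover I A (D (cover I A (Finsupp.single α 1))) : QuotAlgebra I) =
      cover I A (Finsupp.single α 1)
    rw [cover_single, one_smul]
    have h1 := key α 1 1
    rw [one_mul, mul_one, one_mul, mul_one] at h1
    rw [h1, cover_single, bi_smul, idem_mul_arr, arr_mul_idem]
  exact LinearMap.congr_fun this f

end Projective

end BoundQuiver

/-! ### Low-degree coefficients and the radical filtration -/

namespace QuiverPath

variable {V : Type u} [Quiver.{v} V]

theorem eq_nil_or_length_ne_zero {a b : V} (p : Quiver.Path a b) :
    (∃ h : a = b, h ▸ p = Quiver.Path.nil) ∨ p.length ≠ 0 := by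
  cases p with
  | nil => exact Or.inl ⟨rfl, rfl⟩
  | cons p e => exact Or.inr (Nat.succ_ne_zero _)

end QuiverPath

namespace BoundQuiver

open PathAlgebra QuiverPath MulOpposite

variable {k : Type w} {V : Type u} [Field k] [Quiver.{v} V] [Fintype V]
variable {I : TwoSidedIdeal (PathAlgebra k V)} {A : Set (Quiver.Total V)}

open Classical in
-- Paths of length less than two do not occur in elements of I, so their coefficient functionals
-- descend to Λ.
theorem IsAdmissible.exists_coeff (hI : IsAdmissible I) (r : QuiverPath V) (hr : r.length < 2) :
    ∃ f : QuotAlgebra I →ₗ[k] k, ∀ (a b : V) (p : Quiver.Path a b),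
      f (cls I p) = if ⟨a, b, p⟩ = r then 1 else 0 := by
  obtain ⟨f, hf⟩ := exists_lift I ((basis k V).coord r) fun z hz => by
    by_contra h
    exact absurd (hI.two_le_length z hz r h) (by omega)
  refine ⟨f, fun a b p => ?_⟩
  rw [cls, hf]
  exact coeff_single p r

/-- The coefficient of the trivial path at `i`. -/
def vertexCoeff (hI : IsAdmissible I) (i : V) : QuotAlgebra I →ₗ[k] k :=
  (hI.exists_coeff (trivial i) Nat.zero_lt_two).choose

open Classical in
theorem vertexCoeff_cls_eq (hI : IsAdmissible I) (i : V) {a b : V} (p : Quiver.Path a b) :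
    vertexCoeff hI i (cls I p) = if ⟨a, b, p⟩ = trivial i then 1 else 0 :=
  (hI.exists_coeff (trivial i) Nat.zero_lt_two).choose_spec a b p

theorem vertexCoeff_idem (hI : IsAdmissible I) (i : V) : vertexCoeff hI i (idem I i) = 1 := by
  rw [idem_eq_cls, vertexCoeff_cls_eq]
  exact if_pos rfl

theorem vertexCoeff_idem_of_ne (hI : IsAdmissible I) {i j : V} (h : i ≠ j) :
    vertexCoeff hI i (idem I j) = 0 := by
  rw [idem_eq_cls, vertexCoeff_cls_eq]
  exact if_neg fun h' => h (congrArg QuiverPath.source h').symm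

theorem vertexCoeff_cls (hI : IsAdmissible I) {i a b : V} {p : Quiver.Path a b}
    (h : p.length ≠ 0) : vertexCoeff hI i (cls I p) = 0 := by
  rw [vertexCoeff_cls_eq]
  exact if_neg fun h' => by
    have h'' := congrArg QuiverPath.length h'
    exact h h''

theorem vertexCoeff_arr_mul (hI : IsAdmissible I) (i : V) (α : Quiver.Total V)
    (x : QuotAlgebra I) : vertexCoeff hI i (arr I α * x) = 0 := by
  induction x using induction_cls with
  | h0 => rw [mul_zero, map_zero]
  | hadd x y hx hy => rw [mul_add, map_add, hx, hy, add_zero]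
  | hsmul c x hx => rw [mul_smul_comm, map_smul, hx, smul_zero]
  | hcls a b p =>
    by_cases h : α.right = a
    · subst h
      rw [arr, cls_mul_cls]
      refine vertexCoeff_cls hI ?_
      rw [Quiver.Path.length_comp, Quiver.Path.length_toPath]
      omega
    · rw [arr, cls_mul_cls_of_ne h, map_zero]

/-- The coefficient of the arrow `α`. -/
def arrowCoeff (hI : IsAdmissible I) (α : Quiver.Total V) : QuotAlgebra I →ₗ[k] k :=
  (hI.exists_coeff (ofArrow α) Nat.one_lt_two).choose

open Classical in
theorem arrowCoeff_cls_eq (hI : IsAdmissible I) (α : Quiver.Total V) {a b : V}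
    (p : Quiver.Path a b) :
    arrowCoeff hI α (cls I p) = if ⟨a, b, p⟩ = ofArrow α then 1 else 0 :=
  (hI.exists_coeff (ofArrow α) Nat.one_lt_two).choose_spec a b p

theorem arrowCoeff_arr (hI : IsAdmissible I) (α : Quiver.Total V) :
    arrowCoeff hI α (arr I α) = 1 := by
  rw [arr, arrowCoeff_cls_eq]
  exact if_pos rfl

theorem arrowCoeff_arr_of_ne (hI : IsAdmissible I) {α β : Quiver.Total V} (h : α ≠ β) :
    arrowCoeff hI α (arr I β) = 0 := by
  rw [arr, arrowCoeff_cls_eq]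
  refine if_neg fun h' => h ?_
  obtain ⟨a, b, e⟩ := α
  obtain ⟨c, d, f⟩ := β
  simp only [ofArrow, QuiverPath.mk.injEq] at h'
  obtain ⟨rfl, rfl, h'⟩ := h'
  cases eq_of_heq h'
  rfl

theorem arrowCoeff_cls (hI : IsAdmissible I) {α : Quiver.Total V} {a b : V} {p : Quiver.Path a b}
    (h : p.length ≠ 1) : arrowCoeff hI α (cls I p) = 0 := by
  rw [arrowCoeff_cls_eq]
  exact if_neg fun h' => by
    have h'' := congrArg QuiverPath.length h'
    exact h h''

/-- The coefficient of `e_i ⊗ e_j` in the enveloping algebra. -/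
def vertexCoeff₂ (hI : IsAdmissible I) (i j : V) : Env I →ₗ[k] k :=
  vertexCoeff hI j ∘ₗ contractLeft (vertexCoeff hI i)

theorem vertexCoeff₂_bi (hI : IsAdmissible I) (i j : V) (x y : QuotAlgebra I) :
    vertexCoeff₂ hI i j (bi x y) = vertexCoeff hI i x * vertexCoeff hI j y := by
  rw [vertexCoeff₂, LinearMap.comp_apply, contractLeft_bi, map_smul, smul_eq_mul]

theorem induction_bi_cls {P : Env I → Prop} (h0 : P 0) (hadd : ∀ x y, P x → P y → P (x + y))
    (hsmul : ∀ (c : k) x, P x → P (c • x))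
    (hcls : ∀ (a b c d : V) (p : Quiver.Path a b) (q : Quiver.Path c d), P (bi (cls I p) (cls I q)))
    (x : Env I) : P x := by
  induction x using induction_bi with
  | h0 => exact h0
  | hadd x y hx hy => exact hadd x y hx hy
  | hbi x y =>
    induction x using induction_cls with
    | h0 => rwa [bi_zero_left]
    | hadd x x' hx hx' => rw [bi_add_left]; exact hadd _ _ hx hx'
    | hsmul c x hx => rw [bi_smul_left]; exact hsmul _ _ hx
    | hcls a b p =>
      induction y using induction_cls with
      | h0 => rwa [bi_zero_right]
      | hadd x x' hx hx' => rw [bi_add_right]; exact hadd _ _ hx hx'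
      | hsmul c x hx => rw [bi_smul_right]; exact hsmul _ _ hx
      | hcls c d q => exact hcls a b c d p q

theorem smul_smul_eq (c : k) (x : Env I) (y : QuotAlgebra I) : (c • x) • y = c • (x • y) := by
  induction x using induction_bi with
  | h0 => rw [smul_zero, zero_smul, smul_zero]
  | hadd a b ha hb => rw [smul_add, add_smul, add_smul, smul_add, ha, hb]
  | hbi a b => rw [← bi_smul_left, bi_smul, bi_smul, smul_mul_assoc, smul_mul_assoc]

/-- A path pαq has length one only if p and q are trivial, so only the e_{s(α)} ⊗ e_{t(α)} part of x
contributes. -/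
theorem arrowCoeff_smul_arr (hI : IsAdmissible I) (α : Quiver.Total V) (x : Env I) :
    arrowCoeff hI α (x • arr I α) = vertexCoeff₂ hI α.left α.right x := by
  induction x using induction_bi_cls with
  | h0 => rw [zero_smul, map_zero, map_zero]
  | hadd x y hx hy => rw [add_smul, map_add, map_add, hx, hy]
  | hsmul c x hx => rw [smul_smul_eq, LinearMap.map_smul, map_smul (vertexCoeff₂ hI _ _), hx]
  | hcls a b c d p q =>
    rw [bi_smul, vertexCoeff₂_bi]
    by_cases hb : b = α.left
    · by_cases hc : α.right = c
      · subst hb hc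
        rw [arr, cls_mul_cls, cls_mul_cls]
        rcases eq_nil_or_length_ne_zero p with ⟨rfl, h⟩ | h
        · rcases eq_nil_or_length_ne_zero q with ⟨rfl, h'⟩ | h'
          · dsimp only at h h'
            subst h h'
            rw [Quiver.Path.nil_comp, Quiver.Path.comp_nil, ← idem_eq_cls, ← idem_eq_cls,
              vertexCoeff_idem, vertexCoeff_idem, mul_one]
            exact arrowCoeff_arr hI α
          · rw [vertexCoeff_cls hI h', mul_zero, arrowCoeff_cls]
            simp only [Quiver.Path.length_comp, Quiver.Path.length_toPath]
            omega
        · rw [vertexCoeff_cls hI h, zero_mul, arrowCoeff_cls]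
          simp only [Quiver.Path.length_comp, Quiver.Path.length_toPath]
          omega
      · rw [arr, mul_assoc, cls_mul_cls_of_ne hc, mul_zero, map_zero]
        rcases eq_nil_or_length_ne_zero q with ⟨rfl, h'⟩ | h'
        · dsimp only at h'
          rw [h', ← idem_eq_cls, vertexCoeff_idem_of_ne hI hc, mul_zero]
        · rw [vertexCoeff_cls hI h', mul_zero]
    · rw [arr, cls_mul_cls_of_ne hb, zero_mul, map_zero]
      rcases eq_nil_or_length_ne_zero p with ⟨rfl, h'⟩ | h'
      · dsimp only at h'
        rw [h', ← idem_eq_cls, vertexCoeff_idem_of_ne hI (Ne.symm hb), zero_mul]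
      · rw [vertexCoeff_cls hI h', zero_mul]

theorem arrowCoeff_smul_arr_of_ne (hI : IsAdmissible I) {α β : Quiver.Total V} (hαβ : α ≠ β)
    (x : Env I) : arrowCoeff hI α (x • arr I β) = 0 := by
  induction x using induction_bi_cls with
  | h0 => rw [zero_smul, map_zero]
  | hadd x y hx hy => rw [add_smul, map_add, hx, hy, add_zero]
  | hsmul c x hx => rw [smul_smul_eq, LinearMap.map_smul, hx, smul_zero]
  | hcls a b c d p q =>
    rw [bi_smul]
    by_cases hb : b = β.left
    · by_cases hc : β.right = c
      · subst hb hc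
        rcases eq_nil_or_length_ne_zero p with ⟨rfl, h⟩ | h
        · rcases eq_nil_or_length_ne_zero q with ⟨rfl, h'⟩ | h'
          · dsimp only at h h'
            subst h h'
            rw [← idem_eq_cls, ← idem_eq_cls, idem_mul_arr, arr_mul_idem]
            exact arrowCoeff_arr_of_ne hI hαβ
          · rw [arr, cls_mul_cls, cls_mul_cls, arrowCoeff_cls]
            simp only [Quiver.Path.length_comp, Quiver.Path.length_toPath]
            omega
        · rw [arr, cls_mul_cls, cls_mul_cls, arrowCoeff_cls]
          simp only [Quiver.Path.length_comp, Quiver.Path.length_toPath]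
          omega
      · rw [arr, mul_assoc, cls_mul_cls_of_ne hc, mul_zero, map_zero]
    · rw [arr, cls_mul_cls_of_ne hb, zero_mul, map_zero]

/-- The span of the tensors of pairs of paths of total length at least `n`. -/
def radPow (I : TwoSidedIdeal (PathAlgebra k V)) (n : ℕ) : Submodule k (Env I) :=
  Submodule.span k {x | ∃ (a b c d : V) (p : Quiver.Path a b) (q : Quiver.Path c d),
    n ≤ p.length + q.length ∧ x = bi (cls I p) (cls I q)}

theorem bi_cls_mem_radPow {n : ℕ} {a b c d : V} {p : Quiver.Path a b} {q : Quiver.Path c d}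
    (h : n ≤ p.length + q.length) : bi (cls I p) (cls I q) ∈ radPow I n :=
  Submodule.subset_span ⟨a, b, c, d, p, q, h, rfl⟩

theorem mem_radPow_zero (x : Env I) : x ∈ radPow I 0 := by
  induction x using induction_bi_cls with
  | h0 => exact Submodule.zero_mem _
  | hadd x y hx hy => exact Submodule.add_mem _ hx hy
  | hsmul c x hx => exact Submodule.smul_mem _ c hx
  | hcls a b c d p q => exact bi_cls_mem_radPow (Nat.zero_le _)

theorem mul_mem_radPow {m n : ℕ} {x y : Env I} (hx : x ∈ radPow I m) (hy : y ∈ radPow I n) :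
    x * y ∈ radPow I (m + n) := by
  suffices h : radPow I m * radPow I n ≤ radPow I (m + n) from h (Submodule.mul_mem_mul hx hy)
  rw [radPow, radPow, Submodule.span_mul_span, Submodule.span_le]
  rintro _ ⟨_, ⟨a, b, c, d, p, q, h, rfl⟩, _, ⟨a', b', c', d', p', q', h', rfl⟩, rfl⟩
  dsimp only
  rw [bi_mul_bi]
  by_cases hb : b = a'
  · by_cases hc : d' = c
    · subst hb hc
      rw [cls_mul_cls, cls_mul_cls]
      refine bi_cls_mem_radPow ?_
      rw [Quiver.Path.length_comp, Quiver.Path.length_comp]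
      omega
    · rw [cls_mul_cls_of_ne hc, bi_zero_right]
      exact Submodule.zero_mem _
  · rw [cls_mul_cls_of_ne hb, bi_zero_left]
    exact Submodule.zero_mem _

/-- If all paths of length at least m lie in I, a total length of at least 2m forces one of the two
tensor factors to be zero. -/
theorem IsAdmissible.exists_radPow_eq_bot (hI : IsAdmissible I) : ∃ n, radPow I n = ⊥ := by
  obtain ⟨m, hm⟩ := hI.exists_length
  refine ⟨2 * m, Submodule.span_eq_bot.2 ?_⟩
  rintro _ ⟨a, b, c, d, p, q, h, rfl⟩
  by_cases hp : m ≤ p.length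
  · rw [cls_eq_zero_iff.2 (hm _ hp), bi_zero_left]
  · rw [cls_eq_zero_iff.2 (hm ⟨c, d, q⟩ (by change m ≤ q.length; omega)), bi_zero_right]

/-- Right multiplication by e_i ⊗ e_j keeps only pairs of paths p ⊗ q with p ending at i and q
starting at j; of these, only e_i ⊗ e_j has total length zero. -/
theorem mul_bi_idem_sub_mem (hI : IsAdmissible I) (i j : V) (x : Env I) :
    x * bi (idem I i) (idem I j) - vertexCoeff₂ hI i j x • bi (idem I i) (idem I j) ∈
      radPow I 1 := by
  induction x using induction_bi_cls with
  | h0 => rw [zero_mul, map_zero, zero_smul, sub_zero]; exact Submodule.zero_mem _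
  | hadd x y hx hy =>
    rw [add_mul, map_add, add_smul, add_sub_add_comm]
    exact Submodule.add_mem _ hx hy
  | hsmul c x hx =>
    rw [smul_mul_assoc, map_smul, smul_assoc, ← smul_sub]
    exact Submodule.smul_mem _ c hx
  | hcls a b c d p q =>
    rw [bi_mul_bi, vertexCoeff₂_bi]
    by_cases hb : b = i
    · by_cases hc : j = c
      · subst hb hc
        rw [cls_mul_idem, idem_mul_cls]
        rcases eq_nil_or_length_ne_zero p with ⟨rfl, h⟩ | h
        · rcases eq_nil_or_length_ne_zero q with ⟨rfl, h'⟩ | h'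
          · dsimp only at h h'
            subst h h'
            rw [← idem_eq_cls, ← idem_eq_cls, vertexCoeff_idem, vertexCoeff_idem, mul_one, one_smul,
              sub_self]
            exact Submodule.zero_mem _
          · rw [vertexCoeff_cls hI h', mul_zero, zero_smul, sub_zero]
            exact bi_cls_mem_radPow (by omega)
        · rw [vertexCoeff_cls hI h, zero_mul, zero_smul, sub_zero]
          exact bi_cls_mem_radPow (by omega)
      · rw [idem_mul_cls_of_ne hc, bi_zero_right, zero_sub]
        rcases eq_nil_or_length_ne_zero q with ⟨rfl, h'⟩ | h'
        · dsimp only at h'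
          rw [h', ← idem_eq_cls c, vertexCoeff_idem_of_ne hI hc, mul_zero, zero_smul, neg_zero]
          exact Submodule.zero_mem _
        · rw [vertexCoeff_cls hI h', mul_zero, zero_smul, neg_zero]
          exact Submodule.zero_mem _
    · rw [cls_mul_idem_of_ne hb, bi_zero_left, zero_sub]
      rcases eq_nil_or_length_ne_zero p with ⟨rfl, h'⟩ | h'
      · dsimp only at h'
        rw [h', ← idem_eq_cls a, vertexCoeff_idem_of_ne hI (Ne.symm hb), zero_mul, zero_smul,
          neg_zero]
        exact Submodule.zero_mem _
      · rw [vertexCoeff_cls hI h', zero_mul, zero_smul, neg_zero]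
        exact Submodule.zero_mem _

end BoundQuiver

/-! ### From projectivity back to arrow removals -/

namespace QuiverPath

variable {V : Type u} [Quiver.{v} V]

theorem PassesThroughSet.exists_eq_comp {A : Set (Quiver.Total V)} {a b : V} {p : Quiver.Path a b}
    (h : (⟨a, b, p⟩ : QuiverPath V).PassesThroughSet A) :
    ∃ α ∈ A, ∃ (p₁ : Quiver.Path a α.left) (p₂ : Quiver.Path α.right b),
      p = (p₁.comp α.hom.toPath).comp p₂ := h

end QuiverPath

namespace BoundQuiver

open PathAlgebra QuiverPath MulOpposite

variable {k : Type w} {V : Type u} [Field k] [Quiver.{v} V] [Fintype V]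
variable {I : TwoSidedIdeal (PathAlgebra k V)} {A : Set (Quiver.Total V)}

/-- The projection of the free bimodule on `A` onto the sum of the bimodules
`Λ e_{s(α)} ⊗ e_{t(α)} Λ`. -/
def corner (I : TwoSidedIdeal (PathAlgebra k V)) (A : Set (Quiver.Total V)) :
    (A →₀ Env I) →ₗ[Env I] (A →₀ Env I) :=
  Finsupp.linearCombination (Env I) fun α : A =>
    Finsupp.single α (bi (idem I α.1.left) (idem I α.1.right))

theorem corner_single (α : A) (x : Env I) : corner I A (Finsupp.single α x) =
    Finsupp.single α (x * bi (idem I α.1.left) (idem I α.1.right)) := by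
  rw [corner, Finsupp.linearCombination_single, Finsupp.smul_single, smul_eq_mul]

theorem corner_apply (f : A →₀ Env I) (α : A) :
    corner I A f α = f α * bi (idem I α.1.left) (idem I α.1.right) := by
  induction f using Finsupp.induction_linear with
  | zero => simp
  | add f g hf hg => rw [map_add, Finsupp.add_apply, Finsupp.add_apply, hf, hg, add_mul]
  | single β x =>
    rw [corner_single]
    by_cases h : β = α
    · subst h; simp
    · rw [Finsupp.single_eq_of_ne' h, Finsupp.single_eq_of_ne' h, zero_mul]

theorem corner_corner (f : A →₀ Env I) : corner I A (corner I A f) = corner I A f := by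
  refine Finsupp.ext fun α => ?_
  rw [corner_apply, corner_apply, mul_assoc, bi_mul_bi, idem_mul_idem, idem_mul_idem]

theorem cover_corner (f : A →₀ Env I) : cover I A (corner I A f) = cover I A f := by
  induction f using Finsupp.induction_linear with
  | zero => simp
  | add f g hf hg => rw [map_add, map_add, map_add, hf, hg]
  | single β x =>
    refine Subtype.ext ?_
    rw [corner_single, cover_single, cover_single, mul_smul, bi_smul, idem_mul_arr, arr_mul_idem]

theorem arrowCoeff_cover (hI : IsAdmissible I) (f : A →₀ Env I) (α : A) :
    arrowCoeff hI α (cover I A f : QuotAlgebra I) = vertexCoeff₂ hI α.1.left α.1.right (f α) := by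
  induction f using Finsupp.induction_linear with
  | zero => simp
  | add f g hf hg =>
    rw [map_add, Submodule.coe_add, map_add, hf, hg, Finsupp.add_apply, map_add]
  | single β x =>
    rw [cover_single]
    by_cases h : β = α
    · subst h
      rw [arrowCoeff_smul_arr, Finsupp.single_eq_same]
    · rw [arrowCoeff_smul_arr_of_ne hI (fun h' => h (Subtype.ext h'.symm)),
        Finsupp.single_eq_of_ne' h, map_zero]

/-- The degree-zero part of f(α) is read off as the coefficient of α in the image of f under
`cover`, which is 0 here. So the kernel of `cover` on the image of `corner` lies in the radical. -/
theorem apply_mem_radPow_one (hI : IsAdmissible I) {f : A →₀ Env I} (hf : cover I A f = 0)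
    (hf' : corner I A f = f) (α : A) : f α ∈ radPow I 1 := by
  have h := mul_bi_idem_sub_mem hI α.1.left α.1.right (f α)
  rwa [← arrowCoeff_cover, hf, Submodule.coe_zero, map_zero, zero_smul, sub_zero, ← corner_apply,
    hf'] at h

/-- If the ideal generated by `A` is a projective bimodule, then it is the direct sum of the
bimodules `Λ e_{s(α)} ⊗ e_{t(α)} Λ`. -/
theorem corner_eq_zero_of_cover_eq_zero (hI : IsAdmissible I)
    (hP : (arrowIdeal I A).IsProjectiveBimodule k) {f : A →₀ Env I} (hf : cover I A f = 0) :
    corner I A f = 0 := by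
  have := isProjectiveBimodule_iff.1 hP
  obtain ⟨s, hs⟩ := Module.projective_lifting_property (cover I A) LinearMap.id
    (cover_surjective I A)
  have hs' : ∀ y, cover I A (s y) = y := LinearMap.congr_fun hs
  -- The section s yields an idempotent projection π onto the kernel of `cover` inside the image of
  -- `corner`.
  let π : (A →₀ Env I) →ₗ[Env I] (A →₀ Env I) := corner I A - corner I A ∘ₗ s ∘ₗ cover I A
  have hπ : ∀ g, π g = corner I A g - corner I A (s (cover I A g)) := fun g => rfl
  have hcover : ∀ g, cover I A (π g) = 0 := fun g => by
    rw [hπ, map_sub, cover_corner, cover_corner, hs', sub_self]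
  have hcorner : ∀ g, corner I A (π g) = π g := fun g => by
    rw [hπ, map_sub, corner_corner, corner_corner]
  have hππ : ∀ g, π (π g) = π g := fun g => by
    rw [hπ (π g), hcover, map_zero, map_zero, sub_zero, hcorner]
  have hone : ∀ g α, π g α ∈ radPow I 1 := fun g =>
    apply_mem_radPow_one hI (hcover g) (hcorner g)
  -- By linearity π(g) is a combination, with coefficients g(β), of the values of π on the standard
  -- generators, whose entries lie in `radPow I 1`.
  have hstep : ∀ (n : ℕ) (g : A →₀ Env I), (∀ α, g α ∈ radPow I n) →
      ∀ α, π g α ∈ radPow I (n + 1) := by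
    intro n g hg α
    rw [← Finsupp.sum_single g, Finsupp.sum, map_sum, Finsupp.finsetSum_apply]
    refine Submodule.sum_mem _ fun β _ => ?_
    rw [← mul_one (g β), ← smul_eq_mul, ← Finsupp.smul_single, map_smul, Finsupp.smul_apply,
      smul_eq_mul]
    exact mul_mem_radPow (hg β) (hone _ α)
  -- Nakayama-style argument: π = π ∘ π gains one degree at every application, so its values lie in
  -- every power of the radical, eventually in 0.
  have hall : ∀ (n : ℕ) (g : A →₀ Env I) (α : A), π g α ∈ radPow I n := by
    intro n
    induction n with
    | zero => exact fun g α => mem_radPow_zero _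
    | succ n ih =>
      intro g α
      rw [← hππ]
      exact hstep n _ (ih g) α
  obtain ⟨n, hn⟩ := hI.exists_radPow_eq_bot
  have h0 : π f = 0 := Finsupp.ext fun α => by
    have := hall n f α
    rwa [hn, Submodule.mem_bot] at this
  rwa [hπ, hf, map_zero, map_zero, sub_zero] at h0

theorem cornersVanish_of_isProjectiveBimodule (hI : IsAdmissible I)
    (hP : (arrowIdeal I A).IsProjectiveBimodule k) : CornersVanish I A := by
  intro α₁ h₁ α₂ h₂ x
  obtain ⟨q, hq⟩ : ∃ q, q = idem I α₁.right * x * idem I α₂.left := ⟨_, rfl⟩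
  have hql : idem I α₁.right * q = q := by rw [hq, ← mul_assoc, ← mul_assoc, idem_mul_idem]
  have hqr : q * idem I α₂.left = q := by rw [hq, mul_assoc, idem_mul_idem]
  rw [← hq]
  have hinj := fun f : A →₀ Env I => corner_eq_zero_of_cover_eq_zero hI hP (f := f)
  have hqα : q * arr I α₂ = 0 := by
    -- Both elements map to α₁qα₂ under `cover`, once by isolating α₂ and once by isolating α₁, so
    -- they agree after `corner`.
    have h := hinj (Finsupp.single ⟨α₂, h₂⟩ (bi (arr I α₁ * q) 1) -
      Finsupp.single ⟨α₁, h₁⟩ (bi 1 (q * arr I α₂))) (Subtype.ext (by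
        rw [map_sub, Submodule.coe_sub, cover_single, cover_single, bi_smul, bi_smul, mul_one,
          one_mul, mul_assoc, sub_self, Submodule.coe_zero]))
    rw [map_sub, corner_single, corner_single, bi_mul_bi, bi_mul_bi, mul_one, one_mul, ← mul_assoc,
      hql, mul_assoc (arr I α₁), hqr, sub_eq_zero] at h
    -- In the α₁-component, taking the coefficient of e_{s(α₁)} on the left turns e_{s(α₁)} ⊗ qα₂
    -- into qα₂. The other element gives 0: it lies in another component, or its left factor α₁q has
    -- no trivial path.
    have h' := congrArg (fun f => contractLeft (vertexCoeff hI α₁.left) (f ⟨α₁, h₁⟩)) h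
    dsimp only at h'
    rw [Finsupp.single_eq_same, contractLeft_bi, vertexCoeff_idem, one_smul] at h'
    rw [← h']
    by_cases h12 : α₂ = α₁
    · subst h12
      rw [Finsupp.single_eq_same, contractLeft_bi, vertexCoeff_arr_mul, zero_smul]
    · rw [Finsupp.single_eq_of_ne' (fun e => h12 (congrArg Subtype.val e)), map_zero]
  -- Now q ⊗ 1 in the α₂-component maps to qα₂ = 0, hence q ⊗ e_{t(α₂)} = 0, and q = 0 because
  -- e_{t(α₂)} has vertex coefficient 1.
  have h := hinj (Finsupp.single ⟨α₂, h₂⟩ (bi q 1)) (Subtype.ext (by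
    rw [cover_single, bi_smul, mul_one, hqα, Submodule.coe_zero]))
  rw [corner_single, bi_mul_bi, hqr, mul_one, Finsupp.single_eq_zero] at h
  rw [← Module.forall_dual_apply_eq_zero_iff k q]
  intro f
  have h' := congrArg (fun x => vertexCoeff hI α₂.right (contractLeft f x)) h
  dsimp only at h'
  rwa [contractLeft_bi, map_smul, vertexCoeff_idem, map_zero, map_zero, smul_eq_mul, mul_one] at h'

theorem congr_through {M : Type*} [AddCommGroup M] [Module k M] {f g : PathAlgebra k V →ₗ[k] M}
    (h : ∀ (a b : V) (p : Quiver.Path a b), (⟨a, b, p⟩ : QuiverPath V).PassesThroughSet A →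
      f (single k p) = g (single k p)) (z : PathAlgebra k V) :
    f (through A z) = g (through A z) := by
  have : f ∘ₗ (LinearMap.id - avoidingHom k A) = g ∘ₗ (LinearMap.id - avoidingHom k A) := by
    refine linearMap_ext fun a b p => ?_
    classical
    rw [LinearMap.comp_apply, LinearMap.comp_apply, LinearMap.sub_apply, avoidingHom_apply,
      avoiding_single, LinearMap.id_apply]
    split_ifs with hp
    · rw [sub_zero, h a b p hp]
    · rw [sub_self, map_zero, map_zero]
  rw [eq_sub_of_add_eq (through_add_avoiding A z)]
  exact LinearMap.congr_fun this z

/-- The elements of `I` avoiding all arrows of `A`. -/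
def avoidingPart (I : TwoSidedIdeal (PathAlgebra k V)) (A : Set (Quiver.Total V)) :
    Set (PathAlgebra k V) :=
  {z | z ∈ I ∧ avoiding A z = z}

theorem avoidsArrows_avoidingPart : AvoidsArrows (avoidingPart I A) A := fun _ hz =>
  (avoiding_eq_self_iff A _).1 hz.2 _ rfl

/-- Such a path lies in I by the corner condition; if it avoids A it is itself one of the
generators, and `single_mem_of_avoiding` reduces to that case. Thus paths with two occurrences of
arrows of A already vanish modulo the smaller ideal. -/
theorem CornersVanish.single_mem_span (hc : CornersVanish I A) {α₁ α₂ : Quiver.Total V}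
    (h₁ : α₁ ∈ A) (h₂ : α₂ ∈ A) (p : Quiver.Path α₁.right α₂.left) :
    single k p ∈ TwoSidedIdeal.span (avoidingPart I A) := by
  refine single_mem_of_avoiding (fun β₁ hβ₁ β₂ hβ₂ q hq => ?_) h₁ h₂ p
  refine TwoSidedIdeal.subset_span ⟨hc.single_mem hβ₁ hβ₂ q, ?_⟩
  classical
  rw [avoiding_single, if_neg hq]

/-- The map `x ⊗ y ↦ σ(x) c σ(y)`. -/
def sandwich {J : TwoSidedIdeal (PathAlgebra k V)} (σ : QuotAlgebra I →ₗ[k] QuotAlgebra J)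
    (c : QuotAlgebra J) : Env I →ₗ[k] QuotAlgebra J :=
  TensorProduct.lift ((LinearMap.mul k (QuotAlgebra J)).compl₁₂ (LinearMap.mulRight k c ∘ₗ σ)
    (σ ∘ₗ (opLinearEquiv k).symm.toLinearMap))

theorem sandwich_bi {J : TwoSidedIdeal (PathAlgebra k V)} (σ : QuotAlgebra I →ₗ[k] QuotAlgebra J)
    (c : QuotAlgebra J) (x y : QuotAlgebra I) : sandwich σ c (bi x y) = σ x * c * σ y := rfl

theorem sandwich_id (c : QuotAlgebra I) (x : Env I) : sandwich LinearMap.id c x = x • c := by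
  induction x using induction_bi with
  | h0 => rw [map_zero, zero_smul]
  | hadd x y hx hy => rw [map_add, add_smul, hx, hy]
  | hbi a b => rw [sandwich_bi, bi_smul]; rfl

theorem lsum_sandwich_id (f : A →₀ Env I) :
    Finsupp.lsum k (fun α : A => sandwich LinearMap.id (arr I α)) f = (cover I A f) := by
  induction f using Finsupp.induction_linear with
  | zero => simp
  | add f g hf hg => rw [map_add, map_add, hf, hg, Submodule.coe_add]
  | single α x => rw [Finsupp.lsum_single, sandwich_id, cover_single]

/-- The candidate generating set is all of `avoidingPart I A`. It contains z_{∖A} for z ∈ I by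
pre-removability; the work is to show that z_A, whose derivative vanishes by injectivity of `cover`
on the image of `corner`, lies in the ideal it generates. -/
theorem IsPreRemovable.hasGeneratingSetAvoiding (hI : IsAdmissible I) (hA : IsPreRemovable I A)
    (hP : (arrowIdeal I A).IsProjectiveBimodule k) : HasGeneratingSetAvoiding I A := by
  have hc := cornersVanish_of_isProjectiveBimodule hI hP
  refine ⟨avoidingPart I A, le_antisymm (TwoSidedIdeal.span_le.2 fun z hz => hz.1) fun z hz => ?_,
    avoidsArrows_avoidingPart⟩
  set J := TwoSidedIdeal.span (avoidingPart I A) with hJ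
  have hav : ∀ z ∈ I, avoiding A z ∈ J := fun z hz =>
    TwoSidedIdeal.subset_span ⟨(hA z hz).2, avoiding_avoiding A z⟩
  rw [← through_add_avoiding A z]
  refine J.add_mem ?_ (hav z hz)
  -- There need be no evident map from kQ/I to kQ/J, as J ⊆ I. Discarding the paths through A first
  -- makes one, since z_{∖A} ∈ J for z ∈ I.
  obtain ⟨σ, hσ⟩ := exists_lift I ((proj J).toLinearMap ∘ₗ avoidingHom k A) fun z hz =>
    proj_eq_zero_iff.2 (hav z hz)
  have hσ' : ∀ {a b : V} (p : Quiver.Path a b),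
      ¬ (⟨a, b, p⟩ : QuiverPath V).PassesThroughSet A → σ (cls I p) = cls J p := by
    intro a b p hp
    classical
    rw [cls, hσ, LinearMap.comp_apply, avoidingHom_apply, avoiding_single, if_neg hp]
    rfl
  have hσ₀ : ∀ {a b : V} (p : Quiver.Path a b),
      (⟨a, b, p⟩ : QuiverPath V).PassesThroughSet A → σ (cls I p) = 0 := by
    intro a b p hp
    classical
    rw [cls, hσ, LinearMap.comp_apply, avoidingHom_apply, avoiding_single, if_pos hp, map_zero]
  let Φ : (A →₀ Env I) →ₗ[k] QuotAlgebra J :=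
    Finsupp.lsum k fun α : A => sandwich σ (arr J α)
  have hfox : ∀ {a b : V} (α : Quiver.Total V) (hα : α ∈ A) (p : Quiver.Path a α.left)
      (q : Quiver.Path α.right b), fox I A (single k ((p.comp α.hom.toPath).comp q)) =
        Finsupp.single ⟨α, hα⟩ (bi (cls I p) (cls I q)) := by
    intro a b α hα p q
    rw [← single_mul_single, ← single_mul_single, hc.fox_mul_arrow_mul hα]
    change Finsupp.single _ (bi (cls I p * _) (_ * cls I q)) = _
    rw [cls_mul_idem, idem_mul_cls]
  -- Putting the arrow back in place of the tensor sign undoes the derivation on paths through A,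
  -- because with vanishing corners pαq has the single term p ⊗ q.
  have hcover : Finsupp.lsum k (fun α : A => sandwich LinearMap.id (arr I α))
      (fox I A (through A z)) = proj I (through A z) := by
    refine congr_through (f := Finsupp.lsum k (fun α : A => sandwich LinearMap.id (arr I α)) ∘ₗ
      fox I A) (g := (proj I).toLinearMap) (fun a b r hr => ?_) z
    obtain ⟨α, hα, p, q, rfl⟩ := hr.exists_eq_comp
    rw [LinearMap.comp_apply, hfox α hα, Finsupp.lsum_single, sandwich_bi, LinearMap.id_apply,
      LinearMap.id_apply, arr, cls_mul_cls, cls_mul_cls]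
    rfl
  have hcorner : corner I A (fox I A (through A z)) = fox I A (through A z) := by
    refine congr_through (f := (corner I A).restrictScalars k ∘ₗ fox I A) (g := fox I A)
      (fun a b r hr => ?_) z
    obtain ⟨α, hα, p, q, rfl⟩ := hr.exists_eq_comp
    rw [LinearMap.comp_apply, hfox α hα, LinearMap.restrictScalars_apply, corner_single, bi_mul_bi,
      cls_mul_idem, idem_mul_cls]
  -- The same reconstruction works modulo J. If p or q meets A again, σ kills it, and pαq is zero in
  -- kQ/J because it contains a path from the target to the source of arrows of A.
  have hΦ : Φ (fox I A (through A z)) = proj J (through A z) := by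
    refine congr_through (f := Φ ∘ₗ fox I A) (g := (proj J).toLinearMap) (fun a b r hr => ?_) z
    obtain ⟨α, hα, p, q, rfl⟩ := hr.exists_eq_comp
    rw [LinearMap.comp_apply, hfox α hα, Finsupp.lsum_single, sandwich_bi]
    change _ = cls J ((p.comp α.hom.toPath).comp q)
    rw [← cls_mul_cls, ← cls_mul_cls]
    by_cases hp : (⟨_, _, p⟩ : QuiverPath V).PassesThroughSet A
    · rw [hσ₀ p hp, zero_mul, zero_mul]
      obtain ⟨β, hβ, p₁, p₂, rfl⟩ := hp.exists_eq_comp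
      rw [← cls_mul_cls _ p₂, cls_eq_zero_iff.2 (hc.single_mem_span hβ hα p₂), mul_zero, zero_mul,
        zero_mul]
    · by_cases hq : (⟨_, _, q⟩ : QuiverPath V).PassesThroughSet A
      · rw [hσ₀ q hq, mul_zero]
        obtain ⟨β, hβ, q₁, q₂, rfl⟩ := hq.exists_eq_comp
        rw [← cls_mul_cls _ q₂, ← cls_mul_cls q₁,
          cls_eq_zero_iff.2 (hc.single_mem_span hα hβ q₁), zero_mul, zero_mul, mul_zero]
      · rw [hσ' p hp, hσ' q hq]
        rfl
  -- Since z_A ∈ I, its derivative lies in the kernel of `cover`; being fixed by `corner`, it is 0,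
  -- so its image under Φ, the class of z_A in kQ/J, is 0.
  rw [lsum_sandwich_id, proj_eq_zero_iff.2 (hA z hz).1] at hcover
  rw [← proj_eq_zero_iff, ← hΦ, ← hcorner,
    corner_eq_zero_of_cover_eq_zero hI hP (Subtype.ext hcover), map_zero]

end BoundQuiver

end

theorem mainTheorem11 {k : Type w} {V : Type u} [Field k] [Quiver.{v} V] [Fintype V]
    [∀ i j : V, Finite (i ⟶ j)] (I : TwoSidedIdeal (PathAlgebra k V))
    (hI : BoundQuiver.IsAdmissible I) :
    (∀ A : Set (Quiver.Total V), BoundQuiver.IsArrowRemoval I A ↔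
      BoundQuiver.IsPreRemovable I A ∧
        (BoundQuiver.arrowIdeal I A).IsProjectiveBimodule k) ∧
    (∀ α : Quiver.Total V, BoundQuiver.IsArrowRemoval I {α} ↔
      BoundQuiver.HasGeneratingSetAvoiding I {α}) :=
  ⟨fun _ => ⟨fun h => ⟨h.exists_generating.isPreRemovable, h.isProjectiveBimodule⟩,
    fun h => ⟨h.1.hasGeneratingSetAvoiding hI h.2,
      BoundQuiver.cornersVanish_of_isProjectiveBimodule hI h.2⟩⟩,
   fun _ => ⟨fun h => h.exists_generating, fun h => ⟨h, h.cornersVanish hI⟩⟩⟩
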